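/- Let $E$ be a complex Hilbert space (of finite or infinite dimension), let $H_0\ge 0$ be a (possibly unbounded) self-adjoint operator on $E$ with domain $D(H_0)$, and let $V$ be a Hermitian (possibly unbounded) perturbation, given as a sesquilinear form on $D(H_0)$ (for example the form $\langle w, Vu\rangle$ of a symmetric operator whose domain contains $D(H_0)$). Suppose that $\pm V\le v(1+H_0)$ with a real number $v<1$, that is, $$-v\big(\|\varphi\|^2+\langle\varphi,H_0\varphi\rangle\big)\le V(\varphi,\varphi)\le v\big(\|\varphi\|^2+\langle\varphi,H_0\varphi\rangle\big)\qquad\text{for all }\varphi\in D(H_0).$$ For $\varepsilon\in[0,1]$ let $H_\varepsilon=H_0+\varepsilon V$ be the form sum, that is, the self-adjoint operator of the closure of the quadratic form $\langle\varphi,H_0\varphi\rangle+\varepsilon V(\varphi,\varphi)$, $\varphi\in D(H_0)$. An isolated eigenvalue of an operator is an eigenvalue that is an isolated point of its spectrum; the essential spectrum is the spectrum without the isolated eigenvalues of finite multiplicity. Let $\lambda$ be an isolated eigenvalue of $H_0$. 1. If $\lambda$ moves to $\lambda(1)$ as an isolated eigenvalue along $H_0+\varepsilon V$ as $\varepsilon$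 goes from $0$ to $1$, that is, if $\lambda(\cdot):[0,1]\to\mathbb R$ is a continuous function with $\lambda(0)=\lambda$ such that $\lambda(\varepsilon)$ is an isolated eigenvalue of $H_\varepsilon$ for every $\varepsilon\in[0,1]$, then $$|\lambda(1)-\lambda|\le v(1+\lambda).$$ 2. If $\lambda$ has finite multiplicity, it can be followed in this way unless it is absorbed by the essential spectrum: there are $T\in(0,1]$ and a continuous function $\lambda(\cdot):[0,T]\to\mathbb R$ with $\lambda(0)=\lambda$ such that $\lambda(\varepsilon)$ is an isolated eigenvalue of finite multiplicity of $H_\varepsilon$ for all $\varepsilon\in[0,T)$, such that $|\lambda(\varepsilon)-\lambda|\le\varepsilon v(1+\lambda)$ for all $\varepsilon\in[0,T]$, and such that either $T=1$ and $\lambda(1)$ is an isolated eigenvalue of finite multiplicity of $H_1$, or $\lambda(T)$ belongs to the essential spectrum of $H_T$. -/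

import Mathlib

open Set Filter Topology

noncomputable section

namespace EigenvalueShift

variable {E : Type*} [NormedAddCommGroup E] [InnerProductSpace ℂ E]

/-- The energy `⟨u, H₀ u⟩` (its real part, which is all of it when `H₀` is symmetric). -/
def energy (H₀ : E →ₗ.[ℂ] E) (u : H₀.domain) : ℝ :=
  (inner ℂ (u : E) (H₀ u)).re

/-- `H₀ ≥ 0` in the sense of quadratic forms. -/
def Nonneg (H₀ : E →ₗ.[ℂ] E) : Prop :=
  ∀ u : H₀.domain, 0 ≤ energy H₀ u

/-- A (possibly unbounded) sesquilinear form on the domain of `H₀`, conjugate linear in the first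
argument. A symmetric operator `V` whose domain contains that of `H₀` gives the form
`(w, u) ↦ ⟨w, V u⟩`; a form on a larger domain is restricted to the domain of `H₀`. -/
abbrev Form (H₀ : E →ₗ.[ℂ] E) : Type _ :=
  H₀.domain →ₗ⋆[ℂ] H₀.domain →ₗ[ℂ] ℂ

/-- The form is Hermitian (symmetric). -/
def Hermitian {H₀ : E →ₗ.[ℂ] E} (V : Form H₀) : Prop :=
  ∀ u w : H₀.domain, starRingEnd ℂ (V u w) = V w u

/-- `± V ≤ v (1 + H₀)` in the sense of quadratic forms. -/
def RelBounded {H₀ : E →ₗ.[ℂ] E} (V : Form H₀) (v : ℝ) : Prop :=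
  ∀ u : H₀.domain,
    -(v * (‖(u : E)‖ ^ 2 + energy H₀ u)) ≤ (V u u).re ∧
      (V u u).re ≤ v * (‖(u : E)‖ ^ 2 + energy H₀ u)

/-- The sequence `s` in the domain of `H₀` converges to `u` in norm and is Cauchy for the energy
form. The vectors `u` reached in this way make up the form domain of `H₀`. -/
def FormConverges (H₀ : E →ₗ.[ℂ] E) (s : ℕ → H₀.domain) (u : E) : Prop :=
  Tendsto (fun n => (s n : E)) atTop (𝓝 u) ∧
    Tendsto (fun p : ℕ × ℕ => energy H₀ (s p.1 - s p.2)) atTop (𝓝 0)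

theorem energy_add_sub (H₀ : E →ₗ.[ℂ] E) (a b : H₀.domain) :
    energy H₀ (a + b) + energy H₀ (a - b) = 2 * energy H₀ a + 2 * energy H₀ b := by
  simp only [energy, LinearPMap.map_add, LinearPMap.map_sub, Submodule.coe_add, Submodule.coe_sub,
    inner_add_left, inner_add_right, inner_sub_left, inner_sub_right, Complex.add_re,
    Complex.sub_re]
  ring

theorem energy_smul (H₀ : E →ₗ.[ℂ] E) (c : ℂ) (a : H₀.domain) :
    energy H₀ (c • a) = ‖c‖ ^ 2 * energy H₀ a := by
  simp only [energy, LinearPMap.map_smul, Submodule.coe_smul, inner_smul_left, inner_smul_right]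
  rw [← mul_assoc, Complex.mul_conj, Complex.re_ofReal_mul,
    Complex.normSq_eq_norm_sq]

theorem FormConverges.add {H₀ : E →ₗ.[ℂ] E} (h₀ : Nonneg H₀) {s t : ℕ → H₀.domain} {u w : E}
    (hs : FormConverges H₀ s u) (ht : FormConverges H₀ t w) :
    FormConverges H₀ (fun n => s n + t n) (u + w) := by
  refine ⟨by simpa using hs.1.add ht.1, ?_⟩
  have h := (hs.2.const_mul 2).add (ht.2.const_mul 2)
  simp only [mul_zero, add_zero] at h
  refine squeeze_zero (fun p => h₀ _) (fun p => ?_) h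
  have h1 := energy_add_sub H₀ (s p.1 - s p.2) (t p.1 - t p.2)
  have h2 := h₀ ((s p.1 - s p.2) - (t p.1 - t p.2))
  rw [show s p.1 + t p.1 - (s p.2 + t p.2) = (s p.1 - s p.2) + (t p.1 - t p.2) by abel]
  linarith

theorem FormConverges.smul {H₀ : E →ₗ.[ℂ] E} {s : ℕ → H₀.domain} {u : E} (c : ℂ)
    (hs : FormConverges H₀ s u) : FormConverges H₀ (fun n => c • s n) (c • u) := by
  refine ⟨by simpa using hs.1.const_smul c, ?_⟩
  have h := hs.2.const_mul (‖c‖ ^ 2)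
  simp only [mul_zero] at h
  refine h.congr fun p => ?_
  rw [← smul_sub, energy_smul]

/-- The graph of the operator of the form `H₀ + ε V`: the pairs `(u, f)` where `u` lies in the form
domain of `H₀` and the (continuously extended) form satisfies
`⟨w, H₀ u⟩ + ε V(w, u) = ⟨w, f⟩` for all `w` in the form core `D(H₀)`. -/
def formSumGraph (H₀ : E →ₗ.[ℂ] E) (h₀ : Nonneg H₀) (V : Form H₀) (ε : ℝ) :
    Submodule ℂ (E × E) where
  carrier := {p | ∃ s : ℕ → H₀.domain, FormConverges H₀ s p.1 ∧
    ∀ w : H₀.domain, Tendsto (fun n => inner ℂ (w : E) (H₀ (s n)) + (ε : ℂ) * V w (s n)) atTop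
      (𝓝 (inner ℂ (w : E) p.2))}
  zero_mem' := by
    refine ⟨fun _ => 0, ⟨by simp, ?_⟩, fun w => ?_⟩
    · simp [energy]
    · simp
  add_mem' := by
    rintro p q ⟨s, hs, hs'⟩ ⟨t, ht, ht'⟩
    refine ⟨fun n => s n + t n, hs.add h₀ ht, fun w => ?_⟩
    have h := (hs' w).add (ht' w)
    rw [← inner_add_right] at h
    refine h.congr fun n => ?_
    rw [LinearPMap.map_add, map_add, inner_add_right]
    ring
  smul_mem' := by
    rintro c p ⟨s, hs, hs'⟩
    refine ⟨fun n => c • s n, hs.smul c, fun w => ?_⟩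
    have h := (hs' w).const_mul c
    rw [← inner_smul_right] at h
    refine h.congr fun n => ?_
    rw [LinearPMap.map_smul, map_smul, inner_smul_right, smul_eq_mul]
    ring

/-- The operator `H₀ + ε V`, defined as a form sum. Its graph is `formSumGraph`, see
`formSum_graph` below. -/
def formSum (H₀ : E →ₗ.[ℂ] E) (h₀ : Nonneg H₀) (V : Form H₀) (ε : ℝ) : E →ₗ.[ℂ] E :=
  (formSumGraph H₀ h₀ V ε).toLinearPMap

/-- The resolvent set of an unbounded operator `A`: the `z` for which `A - z` is a bijection from
the domain of `A` to `E` with a bounded inverse `R`. -/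
def resolventSet (A : E →ₗ.[ℂ] E) : Set ℂ :=
  {z | ∃ R : E →L[ℂ] E,
    (∀ x : E, ∃ h : R x ∈ A.domain, A ⟨R x, h⟩ - z • R x = x) ∧
      ∀ u : A.domain, R (A u - z • (u : E)) = u}

/-- The spectrum of an unbounded operator. -/
def spectrum (A : E →ₗ.[ℂ] E) : Set ℂ :=
  (resolventSet A)ᶜ

/-- The eigenspace `{u ∈ D(A) | A u = z u}`. -/
def eigenspace (A : E →ₗ.[ℂ] E) (z : ℂ) : Submodule ℂ E :=
  (LinearMap.ker (A.toFun - z • A.domain.subtype)).map A.domain.subtype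

/-- `l` is an eigenvalue of `A` and an isolated point of the spectrum of `A`. -/
def IsIsolatedEigenvalue (A : E →ₗ.[ℂ] E) (l : ℝ) : Prop :=
  eigenspace A (l : ℂ) ≠ ⊥ ∧
    ∃ δ > 0, ∀ z ∈ spectrum A, z ≠ (l : ℂ) → δ ≤ ‖z - (l : ℂ)‖

/-- An isolated eigenvalue of finite multiplicity. -/
def IsDiscreteEigenvalue (A : E →ₗ.[ℂ] E) (l : ℝ) : Prop :=
  IsIsolatedEigenvalue A l ∧ FiniteDimensional ℂ (eigenspace A (l : ℂ))

/-- The essential spectrum (of a self-adjoint operator): the real points of the spectrum that are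
not isolated eigenvalues of finite multiplicity. -/
def essentialSpectrum (A : E →ₗ.[ℂ] E) : Set ℝ :=
  {l | (l : ℂ) ∈ spectrum A ∧ ¬ IsDiscreteEigenvalue A l}

section WellDefined

/-! The form sum is a well-defined operator: the graph is the graph of a function. -/

variable {H₀ : E →ₗ.[ℂ] E}

theorem energy_tendsto_zero (hsym : H₀.IsFormalAdjoint H₀) (h₀ : Nonneg H₀)
    {s : ℕ → H₀.domain} (hs : FormConverges H₀ s 0) :
    Tendsto (fun n => energy H₀ (s n)) atTop (𝓝 0) := by
  rw [Metric.tendsto_atTop]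
  intro η hη
  have h2 := hs.2
  rw [← prod_atTop_atTop_eq] at h2
  have h3 := (h2.eventually (gt_mem_nhds (half_pos hη))).curry
  obtain ⟨N, hN⟩ := eventually_atTop.1 h3
  refine ⟨N, fun n hn => ?_⟩
  have key : ∀ m, energy H₀ (s n) ≤ energy H₀ (s n - s m)
      + 2 * (inner ℂ (s m : E) (H₀ (s n))).re := by
    intro m
    have hc : (inner ℂ (s n : E) (H₀ (s m))).re = (inner ℂ (s m : E) (H₀ (s n))).re := by
      rw [← hsym (s n) (s m), ← inner_conj_symm, Complex.conj_re]
    have hm := h₀ (s m)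
    simp only [energy, LinearPMap.map_sub, Submodule.coe_sub, inner_sub_left, inner_sub_right,
      Complex.sub_re] at hm ⊢
    linarith
  have hlim : Tendsto (fun m => η / 2 + 2 * (inner ℂ (s m : E) (H₀ (s n))).re) atTop
      (𝓝 (η / 2)) := by
    have h4 : Tendsto (fun m => inner ℂ (s m : E) (H₀ (s n))) atTop
        (𝓝 (inner ℂ (0 : E) (H₀ (s n)))) := hs.1.inner tendsto_const_nhds
    have h5 := ((Complex.continuous_re.tendsto _).comp h4).const_mul 2
    simpa using h5.const_add (η / 2)
  have hle : energy H₀ (s n) ≤ η / 2 := by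
    refine ge_of_tendsto hlim ?_
    filter_upwards [hN n hn] with m hm
    exact (key m).trans (by linarith)
  rw [Real.dist_eq, sub_zero, abs_of_nonneg (h₀ _)]
  linarith

theorem form_re_sq_le {V : Form H₀} (hV : Hermitian V) {v : ℝ} (hv : RelBounded V v)
    (w u : H₀.domain) :
    (V w u).re ^ 2 ≤ (v * (‖(w : E)‖ ^ 2 + energy H₀ w)) * (v * (‖(u : E)‖ ^ 2 + energy H₀ u)) := by
  have hpar : ∀ a b : H₀.domain, ‖((a + b : H₀.domain) : E)‖ ^ 2 + energy H₀ (a + b)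
      + (‖((a - b : H₀.domain) : E)‖ ^ 2 + energy H₀ (a - b))
      = 2 * (‖(a : E)‖ ^ 2 + energy H₀ a) + 2 * (‖(b : E)‖ ^ 2 + energy H₀ b) := by
    intro a b
    have h1 := energy_add_sub H₀ a b
    have h2 := parallelogram_law_with_norm ℂ (a : E) (b : E)
    simp only [Submodule.coe_add, Submodule.coe_sub]
    nlinarith
  have hq : ∀ t : ℝ, 0 ≤ (v * (‖(w : E)‖ ^ 2 + energy H₀ w)) * (t * t) + (2 * (V w u).re) * t
      + v * (‖(u : E)‖ ^ 2 + energy H₀ u) := by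
    intro t
    have h1 := (hv (((t : ℂ) • w) + u)).1
    have h2 := (hv (((t : ℂ) • w) - u)).2
    have h3 := hpar ((t : ℂ) • w) u
    have h4 : (V u w).re = (V w u).re := by rw [← hV w u, Complex.conj_re]
    have h5 : (V ((t : ℂ) • w + u) ((t : ℂ) • w + u)).re
        - (V ((t : ℂ) • w - u) ((t : ℂ) • w - u)).re = 4 * (t * (V w u).re) := by
      simp only [map_add, map_sub, LinearMap.add_apply, LinearMap.sub_apply, map_smulₛₗ,
        LinearMap.smul_apply, smul_eq_mul, Complex.conj_ofReal, Complex.add_re, Complex.sub_re,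
        Complex.re_ofReal_mul, RingHom.id_apply, h4]
      ring
    have h6 : ‖(((t : ℂ) • w : H₀.domain) : E)‖ ^ 2 + energy H₀ ((t : ℂ) • w)
        = t ^ 2 * (‖(w : E)‖ ^ 2 + energy H₀ w) := by
      rw [energy_smul, Submodule.coe_smul, norm_smul, mul_pow, Complex.norm_real, Real.norm_eq_abs,
        sq_abs]
      ring
    rw [h6] at h3
    have h7 := congrArg (fun x => v * x) h3
    simp only [mul_add] at h7 h1 h2 ⊢
    nlinarith
  have h := discrim_le_zero hq
  rw [discrim] at h
  nlinarith

theorem form_tendsto_zero (hsym : H₀.IsFormalAdjoint H₀) (h₀ : Nonneg H₀)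
    {V : Form H₀} (hV : Hermitian V) {v : ℝ} (hv : RelBounded V v)
    {s : ℕ → H₀.domain} (hs : FormConverges H₀ s 0) (w : H₀.domain) :
    Tendsto (fun n => V w (s n)) atTop (𝓝 0) := by
  have hre : ∀ w : H₀.domain, Tendsto (fun n => (V w (s n)).re) atTop (𝓝 0) := by
    intro w
    have h1 := (((hs.1.norm).pow 2).add (energy_tendsto_zero hsym h₀ hs)).const_mul v
    have h2 := (h1.const_mul (v * (‖(w : E)‖ ^ 2 + energy H₀ w))).sqrt
    simp only [norm_zero, ne_eq, OfNat.ofNat_ne_zero, not_false_eq_true, zero_pow, add_zero,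
      mul_zero, Real.sqrt_zero] at h2
    refine squeeze_zero_norm (fun n => ?_) h2
    exact Real.abs_le_sqrt (form_re_sq_le hV hv w (s n))
  have him : Tendsto (fun n => (V w (s n)).im) atTop (𝓝 0) := by
    refine (hre (Complex.I • w)).congr fun n => ?_
    simp
  have h := ((Complex.continuous_ofReal.tendsto 0).comp (hre w)).add
    (((Complex.continuous_ofReal.tendsto 0).comp him).mul_const Complex.I)
  simp only [Complex.ofReal_zero, zero_mul, add_zero] at h
  refine h.congr fun n => ?_
  simp [Complex.re_add_im]

theorem formSum_graph [CompleteSpace E] (hsa : IsSelfAdjoint H₀) (h₀ : Nonneg H₀)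
    {V : Form H₀} (hV : Hermitian V) {v : ℝ} (hv : RelBounded V v) (ε : ℝ) :
    (formSum H₀ h₀ V ε).graph = formSumGraph H₀ h₀ V ε := by
  have hdense := hsa.dense_domain
  have hsym : H₀.IsFormalAdjoint H₀ := by
    have h := LinearPMap.adjoint_isFormalAdjoint (T := H₀) hdense
    rwa [LinearPMap.isSelfAdjoint_def.1 hsa] at h
  refine Submodule.toLinearPMap_graph_eq _ ?_
  rintro ⟨u, f⟩ ⟨s, hs, hf⟩ hu
  change u = 0 at hu
  subst hu
  change f = 0
  have hz : ∀ w : H₀.domain, inner ℂ (w : E) f = 0 := by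
    intro w
    refine tendsto_nhds_unique (hf w) ?_
    have h1 : Tendsto (fun n => inner ℂ (w : E) (H₀ (s n))) atTop (𝓝 0) := by
      have h2 : Tendsto (fun n => inner ℂ (H₀ w) (s n : E)) atTop (𝓝 (inner ℂ (H₀ w) (0 : E))) :=
        tendsto_const_nhds.inner hs.1
      rw [inner_zero_right] at h2
      exact h2.congr fun n => hsym w (s n)
    have h3 := h1.add ((form_tendsto_zero hsym h₀ hV hv hs w).const_mul (ε : ℂ))
    simpa using h3
  exact hdense.eq_zero_of_inner_right ℂ (fun x hx => hz ⟨x, hx⟩)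

end WellDefined

end EigenvalueShift

end

/-!
Write `S` for the square root of `(1 + H₀)⁻¹`. The form domain of `H₀` is the range of `S`, and in
the coordinate `y = S⁻¹ u` the form `V` becomes a bounded operator `B` with `-v ≤ B ≤ v`. Hence
`1 + H_ε = S⁻¹ (1 + ε B) S⁻¹` (`IsHalfResolvent.mem_formSumGraph_iff`), and with `T = S²` the number
`z - 1` lies in the resolvent set of `H_ε` exactly when the bounded operator `1 + ε B - z T` is
invertible; eigenspaces correspond likewise (`IsFactored.mem_resolventSet_iff`,
`IsFactored.eigenspace_eq`). The problem is now one on pencils `L - z T` of bounded self-adjoint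
operators with `L` strictly positive.

The tool is a transfer of gaps (`isUnit_of_gap`): if `c₁ L ≤ L' ≤ c₂ L` and `L - z T` is
invertible for `z` in `(a, b)`, then `L' - z T` is invertible for `z` in `(c₂ a, c₁ b)`. After
conjugation with `√L` this is a Neumann series around the midpoint of the gap.

For the shift bound, compare the parameters `s < ε` with the sharp constants
`(1 - ε v) / (1 - s v)` and `(1 + ε v) / (1 + s v)`. Gaps on both sides of an isolated point `α s`
confine the nearby spectrum at `ε` between these multiples of `α s`, so along a continuous path of
isolated points `α ε / (1 + ε v)` decreases and `α ε / (1 - ε v)` increases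
(`Admissible.path_bounds`). With `α = 1 + λ` this is the asserted bound.

For the existence of a path, take a window around a discrete point and let `β ε` be the largest
spectral point in it. The transfer of gaps, applied from `ε` to `ε'` and back, shows that `β` is
defined and Lipschitz near the initial parameter, and a perturbation of finite rank that removes
the discrete point from the window shows that `1 + ε B - z T` stays Fredholm of index zero there,
so that `β ε` is discrete (`Admissible.exists_local_continuation`). Maximal continuations exist by
Zorn's lemma, unless a chain of continuations has no upper bound; as continuations are uniformly
Lipschitz, such a chain has an endpoint, which is spectral and not discrete
(`Admissible.exists_continuation`).
-/

namespace HermitianPencil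

/-! ### Gaps of pencils of self-adjoint operators -/

theorem isUnit_smul_iff_of_ne_zero {R : Type*} [Ring R] [Algebra ℝ R] {z : ℝ} (hz : z ≠ 0)
    (x : R) : IsUnit (z • x) ↔ IsUnit x :=
  isUnit_smul_iff (Units.mk0 z hz) x

section Conj

variable {A : Type*} [CStarAlgebra A]

/-- With `u = √L` this turns the pencil `L - z T` into `1 - z N`, where `N = L^(-1/2) T L^(-1/2)` is
self-adjoint. -/
theorem sub_smul_eq_conj (u : Aˣ) (L T : A) (z : ℂ) :
    L - z • T = u * (↑u⁻¹ * L * ↑u⁻¹ - z • (↑u⁻¹ * T * ↑u⁻¹)) * u := by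
  have h : ∀ x : A, (u : A) * (↑u⁻¹ * x * ↑u⁻¹) * u = x := fun x => by
    simp [mul_assoc]
  rw [mul_sub, sub_mul, h, mul_smul_comm, smul_mul_assoc, h]

theorem isSelfAdjoint_inv_conj {u : Aˣ} (hu : IsSelfAdjoint (u : A)) {T : A}
    (hT : IsSelfAdjoint T) : IsSelfAdjoint ((↑u⁻¹ : A) * T * ↑u⁻¹) := by
  have hi : star (↑u⁻¹ : A) = ↑u⁻¹ := by
    have : star u = u := Units.ext hu
    rw [← Units.coe_star_inv, this]
  have := hT.conjugate (↑u⁻¹ : A)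
  rwa [hi] at this

theorem notMem_spectrum_iff {u : Aˣ} {L T : A} (huL : (u : A) * u = L) {z : ℝ} (hz : z ≠ 0) :
    z⁻¹ ∉ spectrum ℝ ((↑u⁻¹ : A) * T * ↑u⁻¹) ↔ IsUnit (L - (z : ℂ) • T) := by
  have h1 : (↑u⁻¹ : A) * L * ↑u⁻¹ = 1 := by rw [← huL]; simp
  rw [sub_smul_eq_conj u, Units.isUnit_mul_units, Units.isUnit_units_mul, h1, spectrum.notMem_iff,
    Algebra.algebraMap_eq_smul_one, ← isUnit_smul_iff_of_ne_zero hz, smul_sub, smul_smul,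
    mul_inv_cancel₀ hz, one_smul, Complex.coe_smul]

end Conj

section CStarAlgebra

variable {A : Type*} [CStarAlgebra A] [PartialOrder A] [StarOrderedRing A]

theorem norm_le_of_mem_Icc {W : A} {τ : ℝ} (hτ : 0 ≤ τ) (h₁ : algebraMap ℝ A (-τ) ≤ W)
    (h₂ : W ≤ algebraMap ℝ A τ) : ‖W‖ ≤ τ := by
  have hW : IsSelfAdjoint W := by
    have h := (sub_nonneg.2 h₁).isSelfAdjoint.add (IsSelfAdjoint.algebraMap A
      (IsSelfAdjoint.all (-τ)))
    rwa [sub_add_cancel] at h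
  rw [← cfc_id' ℝ W]
  refine norm_cfc_le hτ fun t ht => abs_le.2 ⟨?_, ?_⟩
  · exact (algebraMap_le_iff_le_spectrum hW).1 h₁ t ht
  · exact (le_algebraMap_iff_spectrum_le hW).1 h₂ t ht

/-- If the self-adjoint `N` has no spectrum in `(p, q)`, then `N - (p + q) / 2` has an inverse of
norm at most `2 / (q - p)`, and `D - z N` is a perturbation of `-z (N - (p + q) / 2)` by an operator
of norm less than `z (q - p) / 2`. -/
theorem isUnit_sub_smul_of_gap {N D : A} (hN : IsSelfAdjoint N) {p q c₁ c₂ z : ℝ} (hpq : p < q)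
    (hgap : ∀ r ∈ Ioo p q, r ∉ spectrum ℝ N) (hD₁ : algebraMap ℝ A c₁ ≤ D)
    (hD₂ : D ≤ algebraMap ℝ A c₂) (hz : 0 < z) (h₁ : z * p < c₁) (h₂ : c₂ < z * q) :
    IsUnit (D - z • N) := by
  set m := (p + q) / 2 with hm
  set ρ := (q - p) / 2 with hρ
  have hρ0 : 0 < ρ := by rw [hρ]; linarith
  have hdist : ∀ t ∈ spectrum ℝ N, ρ ≤ |t - m| := by
    intro t ht
    by_contra! hlt
    rw [abs_lt] at hlt
    exact hgap t ⟨by rw [hm, hρ] at hlt; linarith, by rw [hm, hρ] at hlt; linarith⟩ ht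
  have hne : ∀ t ∈ spectrum ℝ N, t - m ≠ 0 := fun t ht h => by
    have := hdist t ht
    rw [h, abs_zero] at this
    linarith
  have hcont : ContinuousOn (fun t : ℝ => (t - m)⁻¹) (spectrum ℝ N) :=
    ContinuousOn.inv₀ (by fun_prop) hne
  set X := cfc (fun t : ℝ => (t - m)⁻¹) N with hX
  have hXnorm : ‖X‖ ≤ ρ⁻¹ := by
    refine norm_cfc_le (by positivity) fun t ht => ?_
    rw [norm_inv, Real.norm_eq_abs]
    exact inv_anti₀ hρ0 (hdist t ht)
  have hNm : N - algebraMap ℝ A m = cfc (fun t : ℝ => t - m) N := by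
    rw [cfc_sub (fun t : ℝ => t) (fun _ => m) N, cfc_id' ℝ N, cfc_const m N]
  have hXr : (N - algebraMap ℝ A m) * X = 1 := by
    rw [hNm, hX, ← cfc_mul (fun t : ℝ => t - m) (fun t : ℝ => (t - m)⁻¹) N (by fun_prop) hcont,
      ← cfc_one ℝ N]
    exact cfc_congr fun t ht => mul_inv_cancel₀ (hne t ht)
  have hXl : X * (N - algebraMap ℝ A m) = 1 := by
    rw [hNm, hX, ← cfc_mul (fun t : ℝ => (t - m)⁻¹) (fun t : ℝ => t - m) N hcont (by fun_prop),
      ← cfc_one ℝ N]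
    exact cfc_congr fun t ht => inv_mul_cancel₀ (hne t ht)
  have hunit : IsUnit (N - algebraMap ℝ A m) := ⟨⟨_, X, hXr, hXl⟩, rfl⟩
  set W := D - algebraMap ℝ A (z * m) with hW
  -- `τ < z ρ` bounds the norm of the perturbation `W`
  obtain ⟨τ, hτ0, hτ1, hτ2, hτ3⟩ : ∃ τ : ℝ, 0 ≤ τ ∧ τ < z * ρ ∧ -τ ≤ c₁ - z * m ∧
      c₂ - z * m ≤ τ := by
    have e1 : z * p = z * m - z * ρ := by rw [hm, hρ]; ring
    have e2 : z * q = z * m + z * ρ := by rw [hm, hρ]; ring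
    refine ⟨max 0 (max (-(c₁ - z * m)) (c₂ - z * m)), le_max_left _ _, ?_, ?_, ?_⟩
    · refine max_lt (by positivity) (max_lt (by linarith) (by linarith))
    · have := le_max_right 0 (max (-(c₁ - z * m)) (c₂ - z * m))
      have := le_max_left (-(c₁ - z * m)) (c₂ - z * m)
      linarith
    · exact (le_max_right _ _).trans (le_max_right _ _)
  have hWnorm : ‖W‖ ≤ τ := by
    refine norm_le_of_mem_Icc hτ0 ?_ ?_
    · calc algebraMap ℝ A (-τ) ≤ algebraMap ℝ A (c₁ - z * m) := algebraMap_mono A hτ2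
        _ = algebraMap ℝ A c₁ - algebraMap ℝ A (z * m) := map_sub _ _ _
        _ ≤ W := sub_le_sub_right hD₁ _
    · calc W ≤ algebraMap ℝ A c₂ - algebraMap ℝ A (z * m) := sub_le_sub_right hD₂ _
        _ = algebraMap ℝ A (c₂ - z * m) := (map_sub _ _ _).symm
        _ ≤ algebraMap ℝ A τ := algebraMap_mono A hτ3
  have hsmall : ‖z⁻¹ • (X * W)‖ < 1 := by
    rw [norm_smul, norm_inv, Real.norm_eq_abs, abs_of_pos hz]
    calc z⁻¹ * ‖X * W‖ ≤ z⁻¹ * (ρ⁻¹ * τ) := by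
          gcongr
          exact (norm_mul_le _ _).trans (mul_le_mul hXnorm hWnorm (norm_nonneg _) (by positivity))
      _ < z⁻¹ * (ρ⁻¹ * (z * ρ)) := by gcongr
      _ = 1 := by field_simp
  have hprod : D - z • N = -(z • ((N - algebraMap ℝ A m) * (1 - z⁻¹ • (X * W)))) := by
    rw [mul_sub, mul_one, mul_smul_comm, ← mul_assoc, hXr, one_mul, smul_sub, smul_smul,
      mul_inv_cancel₀ hz.ne', one_smul, hW, smul_sub, map_mul, ← Algebra.smul_def]
    abel
  rw [hprod, IsUnit.neg_iff, isUnit_smul_iff_of_ne_zero hz.ne']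
  exact hunit.mul (isUnit_one_sub_of_norm_lt_one hsmall)

theorem exists_unit_sqrt {L : A} (hL : IsStrictlyPositive L) :
    ∃ u : Aˣ, IsSelfAdjoint (u : A) ∧ (u : A) * u = L := by
  have h := CFC.sqrt_mul_sqrt_self L hL.nonneg
  have hu : IsUnit (CFC.sqrt L) := by
    have := hL.isUnit
    rw [← h] at this
    exact ((Commute.refl _).isUnit_mul_iff.1 this).1
  exact ⟨hu.unit, (CFC.sqrt_nonneg L).isSelfAdjoint, h⟩

theorem inv_conj_bounds {u : Aˣ} (hu : IsSelfAdjoint (u : A)) {L L' : A} (huL : (u : A) * u = L)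
    {c₁ c₂ : ℝ} (h₁ : (c₁ : ℂ) • L ≤ L') (h₂ : L' ≤ (c₂ : ℂ) • L) :
    algebraMap ℝ A c₁ ≤ (↑u⁻¹ : A) * L' * ↑u⁻¹ ∧ (↑u⁻¹ : A) * L' * ↑u⁻¹ ≤ algebraMap ℝ A c₂ := by
  have hi : IsSelfAdjoint (↑u⁻¹ : A) := by
    simpa using isSelfAdjoint_inv_conj hu hu
  have h1 : ∀ c : ℝ, (↑u⁻¹ : A) * ((c : ℂ) • L) * ↑u⁻¹ = algebraMap ℝ A c := fun c => by
    rw [← huL, Algebra.algebraMap_eq_smul_one, Complex.coe_smul]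
    simp
  rw [← h1 c₁, ← h1 c₂]
  exact ⟨hi.conjugate_le_conjugate h₁, hi.conjugate_le_conjugate h₂⟩

theorem inv_mem_Ioo {a b r : ℝ} (ha : 0 < a) (hr : r ∈ Ioo b⁻¹ a⁻¹) (hab : a < b) :
    0 < r ∧ r⁻¹ ∈ Ioo a b := by
  have hr0 : 0 < r := (inv_pos.2 (ha.trans hab)).trans hr.1
  exact ⟨hr0, (lt_inv_comm₀ ha hr0).2 hr.2, (inv_lt_comm₀ hr0 (ha.trans hab)).2 hr.1⟩

/-- If `c₁ L ≤ L' ≤ c₂ L`, then a gap `(a, b)` of the pencil `L - z T` shrinks at most to the gap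
`(c₂ a, c₁ b)` of the pencil `L' - z T`. -/
theorem isUnit_of_gap {L L' T : A} (hL : IsStrictlyPositive L) (hT : IsSelfAdjoint T)
    {a b c₁ c₂ z : ℝ} (ha : 0 < a) (hc₁ : 0 < c₁) (hc : c₁ ≤ c₂)
    (h₁ : (c₁ : ℂ) • L ≤ L') (h₂ : L' ≤ (c₂ : ℂ) • L)
    (hgap : ∀ z ∈ Ioo a b, IsUnit (L - (z : ℂ) • T)) (hz : z ∈ Ioo (c₂ * a) (c₁ * b)) :
    IsUnit (L' - (z : ℂ) • T) := by
  obtain ⟨u, hu, huL⟩ := exists_unit_sqrt hL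
  have hz0 : 0 < z := (mul_pos (hc₁.trans_le hc) ha).trans hz.1
  have hab : a < b := by
    by_contra! hba
    have := hz.1.trans hz.2
    have := mul_le_mul_of_nonneg_left hba hc₁.le
    have := mul_le_mul_of_nonneg_right hc ha.le
    linarith
  rw [sub_smul_eq_conj u, Units.isUnit_mul_units, Units.isUnit_units_mul, Complex.coe_smul]
  obtain ⟨hb₁, hb₂⟩ := inv_conj_bounds hu huL h₁ h₂
  refine isUnit_sub_smul_of_gap (isSelfAdjoint_inv_conj hu hT) (p := b⁻¹) (q := a⁻¹)
    (inv_strictAnti₀ ha hab) (fun r hr => ?_) hb₁ hb₂ hz0 ?_ ?_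
  · obtain ⟨hr0, hr'⟩ := inv_mem_Ioo ha hr hab
    rw [← inv_inv r, notMem_spectrum_iff huL (inv_pos.2 hr0).ne']
    exact hgap _ hr'
  · rw [← div_eq_mul_inv, div_lt_iff₀ (ha.trans hab)]
    exact hz.2
  · rw [← div_eq_mul_inv, lt_div_iff₀ ha]
    exact hz.1

end CStarAlgebra

/-! ### Operators that are Fredholm of index zero -/

section FiniteRank

variable {E : Type*} [NormedAddCommGroup E] [InnerProductSpace ℂ E]

/-- `T` is the sum of an invertible operator and an operator of finite rank; for a bounded operator
this says that it is Fredholm of index zero. -/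
def IsFredholmZero (T : E →L[ℂ] E) : Prop :=
  ∃ G F : E →L[ℂ] E, IsUnit G ∧ FiniteDimensional ℂ F.range ∧ T = G + F

theorem finiteDimensional_range_comp (X F : E →L[ℂ] E)
    (hF : FiniteDimensional ℂ F.range) : FiniteDimensional ℂ (X * F).range := by
  have : (X * F).range = F.range.map X.toLinearMap := by
    ext; simp
  rw [this]
  infer_instance

theorem finiteDimensional_range_precomp (X F : E →L[ℂ] E)
    (hF : FiniteDimensional ℂ F.range) : FiniteDimensional ℂ (F * X).range :=
  Submodule.finiteDimensional_of_le (S₂ := F.range) (by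
    rintro _ ⟨x, rfl⟩
    exact ⟨X x, rfl⟩)

theorem finiteDimensional_range_add {F G : E →L[ℂ] E}
    (hF : FiniteDimensional ℂ F.range) (hG : FiniteDimensional ℂ G.range) :
    FiniteDimensional ℂ (F + G).range :=
  Submodule.finiteDimensional_of_le (S₂ := F.range ⊔ G.range) (by
    rintro _ ⟨x, rfl⟩
    exact Submodule.add_mem_sup ⟨x, rfl⟩ ⟨x, rfl⟩)

theorem IsFredholmZero.mul_isUnit {T X Y : E →L[ℂ] E} (hT : IsFredholmZero T) (hX : IsUnit X)
    (hY : IsUnit Y) : IsFredholmZero (X * T * Y) := by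
  obtain ⟨G, F, hG, hF, rfl⟩ := hT
  refine ⟨X * G * Y, X * F * Y, (hX.mul hG).mul hY,
    finiteDimensional_range_precomp _ _ (finiteDimensional_range_comp _ _ hF), ?_⟩
  rw [mul_add, add_mul]

theorem IsFredholmZero.add_finiteRank {T F : E →L[ℂ] E} (hT : IsFredholmZero T)
    (hF : FiniteDimensional ℂ F.range) : IsFredholmZero (T + F) := by
  obtain ⟨G, F', hG, hF', rfl⟩ := hT
  exact ⟨G, F' + F, hG, finiteDimensional_range_add hF' hF, add_assoc _ _ _⟩

theorem IsFredholmZero.smul {T : E →L[ℂ] E} (hT : IsFredholmZero T) {c : ℂ} (hc : c ≠ 0) :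
    IsFredholmZero (c • T) := by
  have := hT.mul_isUnit (X := c • 1) (isUnit_one.smul (Units.mk0 c hc)) isUnit_one
  simpa using this

/-- The kernel of `G + F` is contained in `G⁻¹ (range F)`. -/
theorem IsFredholmZero.finiteDimensional_ker {T : E →L[ℂ] E} (hT : IsFredholmZero T) :
    FiniteDimensional ℂ T.ker := by
  obtain ⟨G, F, ⟨u, rfl⟩, hF, rfl⟩ := hT
  refine Submodule.finiteDimensional_of_le
    (S₂ := F.range.map (↑u⁻¹ : E →L[ℂ] E).toLinearMap) fun x hx => ?_
  have h1 : (u : E →L[ℂ] E) x = F (-x) := by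
    have h : (u : E →L[ℂ] E) x + F x = 0 := hx
    rw [map_neg, eq_neg_of_add_eq_zero_left h]
  refine ⟨F (-x), ⟨-x, rfl⟩, ?_⟩
  have h2 : (↑u⁻¹ : E →L[ℂ] E) ((u : E →L[ℂ] E) x) = x := by
    rw [← mul_apply_eq_comp, Units.inv_mul, one_apply_eq_self]
  rw [← h1]
  exact h2

theorem sub_smul_eq_unit_mul {u : (E →L[ℂ] E)ˣ} {L T : E →L[ℂ] E} (huL : (u : E →L[ℂ] E) * u = L)
    {z : ℂ} (hz : z ≠ 0) :
    (u : E →L[ℂ] E) * (↑u⁻¹ * T * ↑u⁻¹ - z⁻¹ • 1) * u = (-z⁻¹) • (L - z • T) := by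
  have h : (u : E →L[ℂ] E) * (↑u⁻¹ * T * ↑u⁻¹) * u = T := by simp [mul_assoc]
  rw [mul_sub, sub_mul, h, mul_smul_comm, smul_mul_assoc, mul_one, huL, smul_sub, smul_smul,
    neg_mul, inv_mul_cancel₀ hz, neg_smul, neg_smul, one_smul]
  abel

variable [CompleteSpace E]

theorem IsFredholmZero.isUnit_of_injective {T : E →L[ℂ] E} (hT : IsFredholmZero T)
    (hinj : ∀ x, T x = 0 → x = 0) : IsUnit T := by
  obtain ⟨G, F, ⟨u, rfl⟩, hF, rfl⟩ := hT
  have hfac : (u : E →L[ℂ] E) + F = u * (1 + ↑u⁻¹ * F) := by simp [mul_add]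
  set K : E →L[ℂ] E := ↑u⁻¹ * F with hK
  have hKfin : FiniteDimensional ℂ K.range := finiteDimensional_range_comp _ _ hF
  have hinj' : ∀ x, x + K x = 0 → x = 0 := fun x hx => hinj x (by
    rw [hfac, mul_apply_eq_comp]
    simp [hx])
  -- `1 + K` maps the finite-dimensional range of `K` injectively, hence surjectively, into itself
  let W := K.range
  let k : W →ₗ[ℂ] W := LinearMap.id + (K.toLinearMap.restrict (p := W) (q := W)
    fun x _ => ⟨x, rfl⟩)
  have hk : Function.Injective k := by
    rw [injective_iff_map_eq_zero]
    intro x hx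
    have : (x : E) + K x = 0 := congrArg Subtype.val hx
    exact Subtype.ext (hinj' _ this)
  have hks := LinearMap.surjective_of_injective hk
  rw [hfac]
  refine u.isUnit.mul ?_
  rw [ContinuousLinearMap.isUnit_iff_bijective]
  constructor
  · rw [injective_iff_map_eq_zero]
    exact fun x hx => hinj' x hx
  · intro y
    obtain ⟨w, hw⟩ := hks ⟨-K y, neg_mem ⟨y, rfl⟩⟩
    have hw' : (w : E) + K w = -K y := congrArg Subtype.val hw
    refine ⟨y + w, ?_⟩
    change y + w + K (y + w) = y
    have h : y + w + K (y + w) = y + K y + (w + K w) := by rw [map_add]; abel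
    rw [h, hw']
    abel

/-- For a self-adjoint operator, a real point at which it is Fredholm of index zero is at most an
isolated point of the spectrum. -/
theorem exists_isUnit_sub_smul_one {N : E →L[ℂ] E} (hN : IsSelfAdjoint N) {r : ℝ}
    (hr : IsFredholmZero (N - (r : ℂ) • 1)) :
    ∃ δ > 0, ∀ z : ℂ, z ≠ r → ‖z - r‖ < δ → IsUnit (N - z • 1) := by
  have hfin := hr.finiteDimensional_ker
  set M := N - (r : ℂ) • (1 : E →L[ℂ] E) with hM
  have hMsa : IsSelfAdjoint M := hN.sub (by
    rw [IsSelfAdjoint, star_smul, star_one, RCLike.star_def, Complex.conj_ofReal])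
  have hsym : ∀ x y, inner ℂ (M x) y = inner ℂ x (M y) := hMsa.isSymmetric
  let P : E →L[ℂ] E := M.ker.starProjection
  have hPker : ∀ x, M (P x) = 0 := fun x => M.ker.starProjection_apply_mem x
  have hMP : M * P = 0 := ContinuousLinearMap.ext hPker
  have hPM : P * M = 0 := by
    refine ContinuousLinearMap.ext fun x => ?_
    change M.ker.starProjection (M x) = 0
    rw [Submodule.starProjection_apply_eq_zero_iff, Submodule.mem_orthogonal]
    intro w hw
    rw [← hsym, show M w = 0 from hw, inner_zero_left]
  have hPP : P * P = P := M.ker.isIdempotentElem_starProjection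
  have hPfin : FiniteDimensional ℂ P.range :=
    Submodule.finiteDimensional_of_le (S₂ := M.ker) (by
      rintro _ ⟨x, rfl⟩
      exact hPker x)
  have hunit : IsUnit (M + P) := by
    refine (hr.add_finiteRank hPfin).isUnit_of_injective fun x hx => ?_
    have hPx : P x = 0 := by
      have h := congrArg P hx
      rw [map_zero, add_apply, map_add, ← mul_apply_eq_comp, hPM,
        ← mul_apply_eq_comp, hPP] at h
      simpa using h
    have hMx : M x = 0 := by simpa [hPx] using hx
    have : P x = x := M.ker.starProjection_eq_self_iff.2 hMx
    rw [← this, hPx]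
  -- `P` is the projection onto the kernel of `M`, and invertibility of `M + P` is an open condition
  obtain ⟨δ, hδ, hball⟩ := Metric.isOpen_iff.1
    (Units.isOpen.preimage (f := fun w : ℂ => M + P - w • (1 : E →L[ℂ] E)) (by fun_prop)) 0
    (by simpa using hunit)
  refine ⟨δ, hδ, fun z hz hzr => ?_⟩
  set w := z - r with hw
  have hw0 : w ≠ 0 := sub_ne_zero.2 hz
  obtain ⟨g, hg⟩ : IsUnit (M + P - w • (1 : E →L[ℂ] E)) := hball (by simpa using hzr)
  have hNz : N - z • (1 : E →L[ℂ] E) = M - w • 1 := by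
    rw [hM, hw, sub_smul]; abel
  have hMg : M - w • (1 : E →L[ℂ] E) = g - P := by rw [hg]; abel
  have hcomm : Commute (g : E →L[ℂ] E) P := by
    rw [hg, commute_iff_eq, sub_mul, add_mul, mul_sub, mul_add, hMP, hPM, smul_mul_assoc,
      mul_smul_comm, one_mul, mul_one]
  have hcomm' : (↑g⁻¹ : E →L[ℂ] E) * P = P * ↑g⁻¹ := (hcomm.units_inv_left).eq
  have hgP : (g : E →L[ℂ] E) * P - P = -(w • P) := by
    rw [hg, sub_mul, add_mul, hMP, hPP, smul_mul_assoc, one_mul]; abel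
  -- the inverse acts as `-w⁻¹` on the kernel and as the inverse of `M + P - w` on its complement
  rw [hNz, hMg]
  have e1 : ((g : E →L[ℂ] E) - P) * (↑g⁻¹ * (1 - P)) = 1 - P := by
    rw [sub_mul, ← mul_assoc, Units.mul_inv, one_mul, ← mul_assoc, ← hcomm', mul_assoc, mul_sub,
      hPP, mul_one, sub_self, mul_zero, sub_zero]
  have e2 : ((g : E →L[ℂ] E) - P) * (w⁻¹ • P) = -P := by
    rw [mul_smul_comm, sub_mul, hPP, hgP, smul_neg, smul_smul, inv_mul_cancel₀ hw0, one_smul]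
  have hcg : Commute ((g : E →L[ℂ] E) - P) (↑g⁻¹ * (1 - P) - w⁻¹ • P) := by
    have c1 : Commute ((g : E →L[ℂ] E) - P) P := hcomm.sub_left (Commute.refl P)
    have c2 : Commute ((g : E →L[ℂ] E) - P) (↑g⁻¹ : E →L[ℂ] E) := by
      refine Commute.sub_left ?_ ?_
      · exact (Commute.refl (g : E →L[ℂ] E)).units_inv_right
      · exact (show Commute (↑g⁻¹ : E →L[ℂ] E) P from hcomm').symm
    exact (c2.mul_right ((Commute.one_right _).sub_right c1)).sub_right (c1.smul_right _)
  have e3 : ((g : E →L[ℂ] E) - P) * (↑g⁻¹ * (1 - P) - w⁻¹ • P) = 1 := by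
    rw [mul_sub, e1, e2]; abel
  exact ⟨⟨_, _, e3, by rw [← hcg.eq, e3]⟩, rfl⟩

/-- The form of `exists_isUnit_sub_smul_one` for pencils: apply it to `N = L^(-1/2) T L^(-1/2)` at
`1 / z`. -/
theorem exists_isUnit_sub_smul {L T : E →L[ℂ] E} (hL : IsStrictlyPositive L)
    (hT : IsSelfAdjoint T) {z : ℝ} (hz : 0 < z) (hF : IsFredholmZero (L - (z : ℂ) • T)) :
    ∃ δ > 0, ∀ w : ℂ, w ≠ z → ‖w - z‖ < δ → IsUnit (L - w • T) := by
  obtain ⟨u, hu, huL⟩ := exists_unit_sqrt hL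
  have hzc : (z : ℂ) ≠ 0 := by exact_mod_cast hz.ne'
  set N : E →L[ℂ] E := ↑u⁻¹ * T * ↑u⁻¹ with hN
  have hNsa : IsSelfAdjoint N := isSelfAdjoint_inv_conj hu hT
  have hfred : IsFredholmZero (N - ((z⁻¹ : ℝ) : ℂ) • (1 : E →L[ℂ] E)) := by
    have h1 := (hF.smul (c := -(z : ℂ)⁻¹) (neg_ne_zero.2 (inv_ne_zero hzc))).mul_isUnit
      u⁻¹.isUnit u⁻¹.isUnit
    rw [← sub_smul_eq_unit_mul huL hzc] at h1
    rw [hN]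
    simpa [mul_assoc] using h1
  obtain ⟨δ, hδ, h⟩ := exists_isUnit_sub_smul_one hNsa hfred
  have hcont : ContinuousAt (fun w : ℂ => w⁻¹) z := continuousAt_inv₀ hzc
  obtain ⟨η, hη, hη'⟩ := Metric.continuousAt_iff.1 hcont δ hδ
  refine ⟨min η z, lt_min hη hz, fun w hw hwz => ?_⟩
  have hw0 : w ≠ 0 := by
    rintro rfl
    have := hwz.trans_le (min_le_right _ _)
    rw [zero_sub, norm_neg, Complex.norm_real, Real.norm_eq_abs, abs_of_pos hz] at this
    exact lt_irrefl _ this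
  have h2 := h w⁻¹ (by rw [Complex.ofReal_inv]; exact fun h => hw (inv_injective h)) (by
    have := hη' (x := w) (by rw [dist_eq_norm]; exact hwz.trans_le (min_le_left _ _))
    rwa [dist_eq_norm, ← Complex.ofReal_inv] at this)
  have h3 := (u.isUnit.mul h2).mul u.isUnit
  rw [sub_smul_eq_unit_mul huL hw0] at h3
  exact (isUnit_smul_iff (Units.mk0 (-w⁻¹) (neg_ne_zero.2 (inv_ne_zero hw0))) _).1 h3

/-- The eigenvalue `z₀` of finite multiplicity is moved to the end of the gap `(a, b)` by a
perturbation of finite rank; what is left has no spectrum in the gap, and `isUnit_of_gap` applies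
to it. -/
theorem isFredholmZero_of_isolated {L L' T : E →L[ℂ] E} (hL : IsStrictlyPositive L)
    (hT : IsSelfAdjoint T) {a b c₁ c₂ z₀ z : ℝ} (ha : 0 < a) (hc₁ : 0 < c₁) (hc : c₁ ≤ c₂)
    (h₁ : (c₁ : ℂ) • L ≤ L') (h₂ : L' ≤ (c₂ : ℂ) • L) (hz₀ : z₀ ∈ Ioo a b)
    (hgap : ∀ z ∈ Ioo a b, z ≠ z₀ → IsUnit (L - (z : ℂ) • T))
    (hfin : FiniteDimensional ℂ (L - (z₀ : ℂ) • T).ker) (hz : z ∈ Ioo (c₂ * a) (c₁ * b)) :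
    IsFredholmZero (L' - (z : ℂ) • T) := by
  obtain ⟨u, hu, huL⟩ := exists_unit_sqrt hL
  have hz0 : 0 < z := (mul_pos (hc₁.trans_le hc) ha).trans hz.1
  have hab : a < b := hz₀.1.trans hz₀.2
  have hz₀0 : 0 < z₀ := ha.trans hz₀.1
  set N : E →L[ℂ] E := ↑u⁻¹ * T * ↑u⁻¹ with hN
  have hNsa : IsSelfAdjoint N := isSelfAdjoint_inv_conj hu hT
  have hspec : ∀ t ∈ spectrum ℝ N, t ∈ Ioo b⁻¹ a⁻¹ → t = z₀⁻¹ := by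
    intro t ht htI
    by_contra hne
    obtain ⟨ht0, ht'⟩ := inv_mem_Ioo ha htI hab
    refine (notMem_spectrum_iff huL (inv_pos.2 ht0).ne').2
      (hgap _ ht' fun h => hne (by rw [← h, inv_inv])) ?_
    rwa [inv_inv]
  have hr : z₀⁻¹ ∈ Ioo b⁻¹ a⁻¹ := ⟨inv_strictAnti₀ hz₀0 hz₀.2, inv_strictAnti₀ ha hz₀.1⟩
  -- `z₀⁻¹` is isolated in the spectrum of `N`, so its indicator is continuous on the spectrum
  set χ : ℝ → ℝ := fun t => if t = z₀⁻¹ then 1 else 0 with hχ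
  have hχc : ContinuousOn χ (spectrum ℝ N) := by
    intro x hx
    by_cases hxr : x = z₀⁻¹
    · refine (continuousWithinAt_const (b := (1 : ℝ))).congr_of_eventuallyEq ?_ (by simp [hχ, hxr])
      have : ∀ᶠ t in 𝓝[spectrum ℝ N] x, t ∈ Ioo b⁻¹ a⁻¹ :=
        mem_nhdsWithin_of_mem_nhds (isOpen_Ioo.mem_nhds (hxr ▸ hr))
      filter_upwards [this, self_mem_nhdsWithin] with t ht ht'
      simp [hχ, hspec t ht' ht]
    · refine (continuousWithinAt_const (b := (0 : ℝ))).congr_of_eventuallyEq ?_ (by simp [hχ, hxr])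
      have : ∀ᶠ t in 𝓝[spectrum ℝ N] x, t ≠ z₀⁻¹ :=
        mem_nhdsWithin_of_mem_nhds (isOpen_ne.mem_nhds hxr)
      filter_upwards [this] with t ht
      simp [hχ, ht]
  set P := cfc χ N with hP
  set κ := a⁻¹ - z₀⁻¹ with hκ
  -- `N + κ P` has the spectrum of `N`, with `z₀⁻¹` moved to the end `a⁻¹` of the gap
  have hN' : cfc (fun t => t + κ * χ t) N = N + κ • P := by
    rw [cfc_add N (fun t : ℝ => t) (fun t => κ * χ t) continuousOn_id
      (continuousOn_const.mul hχc), cfc_id' ℝ N,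
      cfc_const_mul κ χ N hχc]
  have hN'sa : IsSelfAdjoint (N + κ • P) := hN' ▸ cfc_predicate _ N
  have hN'gap : ∀ t ∈ Ioo b⁻¹ a⁻¹, t ∉ spectrum ℝ (N + κ • P) := by
    intro t ht hts
    rw [← hN', cfc_map_spectrum (fun t => t + κ * χ t) N
      (hf := continuousOn_id.add (continuousOn_const.mul hχc))] at hts
    obtain ⟨x, hx, rfl⟩ := hts
    by_cases hxr : x = z₀⁻¹
    · simp [hχ, hxr, hκ] at ht
    · simp only [hχ, hxr, if_false, mul_zero, add_zero] at ht
      exact hxr (hspec x hx ht)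
  have hNP : N * P = z₀⁻¹ • P := by
    rw [hP, ← cfc_const_mul z₀⁻¹ χ N hχc]
    nth_rewrite 1 [← cfc_id' ℝ N]
    rw [← cfc_mul (fun t : ℝ => t) χ N (by fun_prop) hχc]
    refine cfc_congr fun t _ => ?_
    by_cases htr : t = z₀⁻¹ <;> simp [hχ, htr]
  have hPfin : FiniteDimensional ℂ P.range := by
    refine Submodule.finiteDimensional_of_le
      (S₂ := (L - (z₀ : ℂ) • T).ker.map (u : E →L[ℂ] E).toLinearMap) ?_
    rintro _ ⟨x, rfl⟩
    have hzc : (z₀ : ℂ) ≠ 0 := by exact_mod_cast hz₀0.ne'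
    have hzero : (N - (z₀ : ℂ)⁻¹ • 1) * P = 0 := by
      rw [sub_mul, hNP, smul_mul_assoc, one_mul, ← Complex.ofReal_inv, Complex.coe_smul, sub_self]
    have h2 : (L - (z₀ : ℂ) • T) * (↑u⁻¹ * P) = 0 := by
      have h := sub_smul_eq_unit_mul (T := T) huL hzc
      have h3 : (-(z₀ : ℂ)⁻¹) • ((L - (z₀ : ℂ) • T) * (↑u⁻¹ * P)) = 0 := by
        rw [← smul_mul_assoc, ← h, mul_assoc, Units.mul_inv_cancel_left, mul_assoc, hzero, mul_zero]
      exact (smul_eq_zero.1 h3).resolve_left (neg_ne_zero.2 (inv_ne_zero hzc))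
    refine ⟨(↑u⁻¹ * P : E →L[ℂ] E) x, ?_, ?_⟩
    · exact congrArg (fun S : E →L[ℂ] E => S x) h2
    · change ((u : E →L[ℂ] E) * (↑u⁻¹ * P)) x = P x
      rw [Units.mul_inv_cancel_left]
  obtain ⟨hb₁, hb₂⟩ := inv_conj_bounds hu huL h₁ h₂
  have hunit : IsUnit (↑u⁻¹ * L' * ↑u⁻¹ - z • (N + κ • P)) := by
    refine isUnit_sub_smul_of_gap hN'sa (inv_strictAnti₀ ha hab) hN'gap hb₁ hb₂ hz0 ?_ ?_
    · rw [← div_eq_mul_inv, div_lt_iff₀ (ha.trans hab)]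
      exact hz.2
    · rw [← div_eq_mul_inv, lt_div_iff₀ ha]
      exact hz.1
  rw [sub_smul_eq_conj u]
  refine IsFredholmZero.mul_isUnit ⟨_, ((z * κ : ℝ) : ℂ) • P, hunit, ?_, ?_⟩ u.isUnit u.isUnit
  · exact Submodule.finiteDimensional_of_le (S₂ := P.range) (by
      rintro _ ⟨x, rfl⟩
      exact Submodule.smul_mem _ _ ⟨x, rfl⟩)
  · rw [Complex.coe_smul, Complex.coe_smul, smul_add, smul_smul, ← hN]
    abel

end FiniteRank

/-! ### The pencils `1 + ε B - z T` and their paths of isolated points -/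

section Family

variable {E : Type*} [NormedAddCommGroup E] [InnerProductSpace ℂ E]

/-- `z` is an eigenvalue of the pencil `L - w T` and the only point near `z` at which the pencil is
not invertible. -/
def IsIsolatedPoint (L T : E →L[ℂ] E) (z : ℝ) : Prop :=
  (L - (z : ℂ) • T).ker ≠ ⊥ ∧ ∃ δ > 0, ∀ w : ℂ, w ≠ z → ‖w - z‖ < δ → IsUnit (L - w • T)

/-- An isolated eigenvalue of finite multiplicity of the pencil `L - w T`. -/
def IsDiscretePoint (L T : E →L[ℂ] E) (z : ℝ) : Prop :=
  IsIsolatedPoint L T z ∧ FiniteDimensional ℂ (L - (z : ℂ) • T).ker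

theorem not_isUnit_of_ker_ne_bot {X : E →L[ℂ] E} (h : X.ker ≠ ⊥) : ¬ IsUnit X := by
  rintro ⟨u, rfl⟩
  refine h ((Submodule.eq_bot_iff _).2 fun x hx => ?_)
  have h2 : (↑u⁻¹ : E →L[ℂ] E) ((u : E →L[ℂ] E) x) = x := by
    rw [← mul_apply_eq_comp, Units.inv_mul, one_apply_eq_self]
  rw [← h2, show (u : E →L[ℂ] E) x = 0 from hx, map_zero]

variable [CompleteSpace E]

theorem isDiscretePoint_of_isFredholmZero {L T : E →L[ℂ] E} (hL : IsStrictlyPositive L)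
    (hT : IsSelfAdjoint T) {z : ℝ} (hz : 0 < z) (hF : IsFredholmZero (L - (z : ℂ) • T))
    (hu : ¬ IsUnit (L - (z : ℂ) • T)) : IsDiscretePoint L T z :=
  ⟨⟨fun h => hu (hF.isUnit_of_injective fun x hx => (Submodule.eq_bot_iff _).1 h x hx),
    exists_isUnit_sub_smul hL hT hz hF⟩, hF.finiteDimensional_ker⟩

/-- The standing assumptions on the family of pencils `1 + ε B - z T`: the operator `T` is
nonnegative and `-v ≤ B ≤ v` with `0 ≤ v < 1`. -/
structure Admissible (B T : E →L[ℂ] E) (v : ℝ) : Prop where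
  nonneg : 0 ≤ T
  v_nonneg : 0 ≤ v
  v_lt_one : v < 1
  neg_le : ((-v : ℝ) : ℂ) • 1 ≤ B
  le : B ≤ (v : ℂ) • 1

variable {B T : E →L[ℂ] E} {v : ℝ}

theorem real_smul_nonneg {X : E →L[ℂ] E} (hX : 0 ≤ X) {c : ℝ} (hc : 0 ≤ c) :
    0 ≤ (c : ℂ) • X := by
  rw [Complex.coe_smul]
  exact smul_nonneg hc hX

theorem Admissible.affine_nonneg (h : Admissible B T v) {α β : ℝ} (hαβ : |β| * v ≤ α) :
    0 ≤ (α : ℂ) • (1 : E →L[ℂ] E) + (β : ℂ) • B := by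
  rcases le_total 0 β with hβ | hβ
  · rw [abs_of_nonneg hβ] at hαβ
    have e : (α : ℂ) • (1 : E →L[ℂ] E) + (β : ℂ) • B
        = ((α - β * v : ℝ) : ℂ) • 1 + (β : ℂ) • (B - ((-v : ℝ) : ℂ) • 1) := by
      push_cast; module
    rw [e]
    exact add_nonneg (real_smul_nonneg zero_le_one (by linarith))
      (real_smul_nonneg (sub_nonneg.2 h.neg_le) hβ)
  · rw [abs_of_nonpos hβ] at hαβ
    have e : (α : ℂ) • (1 : E →L[ℂ] E) + (β : ℂ) • B
        = ((α + β * v : ℝ) : ℂ) • 1 + ((-β : ℝ) : ℂ) • ((v : ℂ) • 1 - B) := by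
      push_cast; module
    rw [e]
    exact add_nonneg (real_smul_nonneg zero_le_one (by linarith))
      (real_smul_nonneg (sub_nonneg.2 h.le) (by linarith))

theorem Admissible.isStrictlyPositive (h : Admissible B T v) {ε : ℝ} (hε : ε ∈ Icc (0 : ℝ) 1) :
    IsStrictlyPositive (1 + (ε : ℂ) • B) := by
  have h0 := h.v_nonneg
  have h1 := h.v_lt_one
  have hpos : 0 < 1 - ε * v := by nlinarith [hε.1, hε.2]
  have hs : IsStrictlyPositive (((1 - ε * v : ℝ) : ℂ) • (1 : E →L[ℂ] E)) := by
    rw [Complex.coe_smul]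
    exact isStrictlyPositive_one.smul hpos
  refine hs.of_le ?_
  rw [← sub_nonneg]
  have := h.affine_nonneg (α := ε * v) (β := ε) (by rw [abs_of_nonneg hε.1])
  convert this using 1
  push_cast; module

theorem Admissible.pos_of_not_isUnit (h : Admissible B T v) {ε z : ℝ} (hε : ε ∈ Icc (0 : ℝ) 1)
    (hz : ¬ IsUnit (1 + (ε : ℂ) • B - (z : ℂ) • T)) : 0 < z := by
  by_contra! hz0
  refine hz ?_
  have h1 := (h.isStrictlyPositive hε).add_nonneg
    (real_smul_nonneg h.nonneg (neg_nonneg.2 hz0))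
  have := h1.isUnit
  rwa [Complex.ofReal_neg, neg_smul, ← sub_eq_add_neg] at this

/-- The conditions on `c₁` and `c₂` say that `c₁ (1 + s x) ≤ 1 + t x ≤ c₂ (1 + s x)` for `|x| ≤ v`,
so that `c₁ (1 + s B) ≤ 1 + t B ≤ c₂ (1 + s B)`. -/
theorem Admissible.isUnit_of_gap (h : Admissible B T v) {s t c₁ c₂ a b z : ℝ}
    (hs : s ∈ Icc (0 : ℝ) 1) (hc₁ : 0 < c₁) (h₁ : |t - c₁ * s| * v ≤ 1 - c₁)
    (h₂ : |t - c₂ * s| * v ≤ c₂ - 1) (ha : 0 < a)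
    (hgap : ∀ z ∈ Ioo a b, IsUnit (1 + (s : ℂ) • B - (z : ℂ) • T))
    (hz : z ∈ Ioo (c₂ * a) (c₁ * b)) : IsUnit (1 + (t : ℂ) • B - (z : ℂ) • T) := by
  have hv := h.v_nonneg
  have hle₁ : c₁ ≤ 1 := by nlinarith [mul_nonneg (abs_nonneg (t - c₁ * s)) hv]
  have hle₂ : 1 ≤ c₂ := by nlinarith [mul_nonneg (abs_nonneg (t - c₂ * s)) hv]
  refine HermitianPencil.isUnit_of_gap (h.isStrictlyPositive hs) h.nonneg.isSelfAdjoint ha hc₁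
    (hle₁.trans hle₂) ?_ ?_ hgap hz
  · rw [← sub_nonneg]
    convert h.affine_nonneg h₁ using 1
    push_cast; module
  · rw [← sub_nonneg]
    convert h.affine_nonneg (α := c₂ - 1) (β := -(t - c₂ * s)) (by rwa [abs_neg]) using 1
    push_cast; module

theorem Admissible.isFredholmZero_of_isolated (h : Admissible B T v) {s t c₁ c₂ a b z₀ z : ℝ}
    (hs : s ∈ Icc (0 : ℝ) 1) (hc₁ : 0 < c₁) (h₁ : |t - c₁ * s| * v ≤ 1 - c₁)
    (h₂ : |t - c₂ * s| * v ≤ c₂ - 1) (ha : 0 < a) (hz₀ : z₀ ∈ Ioo a b)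
    (hgap : ∀ z ∈ Ioo a b, z ≠ z₀ → IsUnit (1 + (s : ℂ) • B - (z : ℂ) • T))
    (hfin : FiniteDimensional ℂ (1 + (s : ℂ) • B - (z₀ : ℂ) • T).ker)
    (hz : z ∈ Ioo (c₂ * a) (c₁ * b)) : IsFredholmZero (1 + (t : ℂ) • B - (z : ℂ) • T) := by
  have hv := h.v_nonneg
  have hle₁ : c₁ ≤ 1 := by nlinarith [mul_nonneg (abs_nonneg (t - c₁ * s)) hv]
  have hle₂ : 1 ≤ c₂ := by nlinarith [mul_nonneg (abs_nonneg (t - c₂ * s)) hv]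
  refine HermitianPencil.isFredholmZero_of_isolated (h.isStrictlyPositive hs)
    h.nonneg.isSelfAdjoint ha hc₁ (hle₁.trans hle₂) ?_ ?_ hz₀ hgap hfin hz
  · rw [← sub_nonneg]
    convert h.affine_nonneg h₁ using 1
    push_cast; module
  · rw [← sub_nonneg]
    convert h.affine_nonneg (α := c₂ - 1) (β := -(t - c₂ * s)) (by rwa [abs_neg]) using 1
    push_cast; module

/-- A continuous function that does not exceed `f x` immediately to the right of any `x` does not
increase. -/
theorem apply_le_of_eventually_le {f : ℝ → ℝ} {a b : ℝ} (hab : a ≤ b)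
    (hf : ContinuousOn f (Icc a b)) (h : ∀ x ∈ Ico a b, ∀ᶠ y in 𝓝[>] x, f y ≤ f x) :
    f b ≤ f a := by
  refine image_le_of_liminf_slope_right_le_deriv_boundary (B := fun _ => f a) (B' := fun _ => 0)
    hf le_rfl continuousOn_const (fun x _ => (hasDerivWithinAt_const x _ (f a)))
    (fun x hx r hr => ?_) (right_mem_Icc.2 hab)
  refine Eventually.frequently ?_
  filter_upwards [h x hx, self_mem_nhdsWithin] with y hy hxy
  refine lt_of_le_of_lt ?_ hr
  rw [slope_def_field]
  exact div_nonpos_of_nonpos_of_nonneg (by linarith) (sub_nonneg.2 (le_of_lt hxy))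

/-- Near an isolated point `α s`, the spectrum of the pencil at `ε > s` is confined to the interval
given by the comparison of `1 + ε B` with `1 + s B`; a continuous path of spectral points has no
choice but to stay in it. -/
theorem Admissible.eventually_mem_Icc (h : Admissible B T v) {s t : ℝ} (hs : s ∈ Icc (0 : ℝ) 1)
    (hst : s < t) {α : ℝ → ℝ} (hα : ContinuousOn α (Icc s t))
    (hiso : IsIsolatedPoint (1 + (s : ℂ) • B) T (α s))
    (hspec : ∀ ε ∈ Ico s t, ¬ IsUnit (1 + (ε : ℂ) • B - (α ε : ℂ) • T)) :
    ∀ᶠ ε in 𝓝[>] s, (1 - ε * v) / (1 - s * v) * α s ≤ α ε ∧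
      α ε ≤ (1 + ε * v) / (1 + s * v) * α s := by
  have hv := h.v_nonneg
  have hv1 := h.v_lt_one
  have hm : 0 < 1 - s * v := by nlinarith [hs.1, hs.2]
  have hp : 0 < 1 + s * v := by nlinarith [hs.1, hs.2]
  have hα0 : 0 < α s := h.pos_of_not_isUnit hs (hspec s (left_mem_Ico.2 hst))
  obtain ⟨δ, hδ, hunit⟩ := hiso.2
  set r := min (δ / 2) (α s / 2) with hr
  have hr0 : 0 < r := lt_min (by linarith) (by linarith)
  have hrδ : r < δ := (min_le_left _ _).trans_lt (by linarith)
  have hrα : r < α s := (min_le_right _ _).trans_lt (by linarith)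
  have hgap : ∀ z : ℝ, |z - α s| < r → z ≠ α s → IsUnit (1 + (s : ℂ) • B - (z : ℂ) • T) := by
    intro z hz hne
    refine hunit z (by exact_mod_cast hne) ?_
    rw [← Complex.ofReal_sub, Complex.norm_real]
    exact hz.trans hrδ
  have hαlim : Tendsto α (𝓝[>] s) (𝓝 (α s)) :=
    ((hα s (left_mem_Icc.2 hst.le)).mono_of_mem_nhdsWithin (Icc_mem_nhdsGT hst)).tendsto
  have hc₁ : Tendsto (fun ε => (1 - ε * v) / (1 - s * v)) (𝓝[>] s) (𝓝 1) := by
    have : Tendsto (fun ε => (1 - ε * v) / (1 - s * v)) (𝓝 s) (𝓝 ((1 - s * v) / (1 - s * v))) :=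
      Continuous.tendsto (by fun_prop) s
    rw [div_self hm.ne'] at this
    exact this.mono_left nhdsWithin_le_nhds
  have hc₂ : Tendsto (fun ε => (1 + ε * v) / (1 + s * v)) (𝓝[>] s) (𝓝 1) := by
    have : Tendsto (fun ε => (1 + ε * v) / (1 + s * v)) (𝓝 s) (𝓝 ((1 + s * v) / (1 + s * v))) :=
      Continuous.tendsto (by fun_prop) s
    rw [div_self hp.ne'] at this
    exact this.mono_left nhdsWithin_le_nhds
  have e1 := (hc₂.mul_const (α s - r)).eventually_lt hαlim (by linarith)
  have e2 := hαlim.eventually_lt (hc₁.mul_const (α s + r)) (by linarith)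
  filter_upwards [e1, e2, hc₁.eventually (lt_mem_nhds zero_lt_one), Ioo_mem_nhdsGT hst]
    with ε e1 e2 hpos hε
  have hm' := hm.ne'
  have hp' := hp.ne'
  have hd : 0 < ε - s := sub_pos.2 hε.1
  have b₁ : |ε - (1 - ε * v) / (1 - s * v) * s| * v ≤ 1 - (1 - ε * v) / (1 - s * v) := by
    have e : ε - (1 - ε * v) / (1 - s * v) * s = (ε - s) / (1 - s * v) := by
      rw [eq_div_iff hm', sub_mul, mul_right_comm, div_mul_cancel₀ _ hm']; ring
    rw [e, abs_of_nonneg (by positivity)]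
    apply le_of_eq
    field_simp
    ring
  have b₂ : |ε - (1 + ε * v) / (1 + s * v) * s| * v ≤ (1 + ε * v) / (1 + s * v) - 1 := by
    have e : ε - (1 + ε * v) / (1 + s * v) * s = (ε - s) / (1 + s * v) := by
      rw [eq_div_iff hp', sub_mul, mul_right_comm, div_mul_cancel₀ _ hp']; ring
    rw [e, abs_of_nonneg (by positivity)]
    apply le_of_eq
    field_simp
    ring
  have hns := hspec ε ⟨hε.1.le, hε.2⟩
  constructor
  · by_contra! hlt
    refine hns (h.isUnit_of_gap hs hpos b₁ b₂ (a := α s - r) (b := α s) (by linarith)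
      (fun z hz => hgap z ?_ hz.2.ne) ⟨e1, hlt⟩)
    rw [abs_lt]; constructor <;> linarith [hz.1, hz.2]
  · by_contra! hlt
    refine hns (h.isUnit_of_gap hs hpos b₁ b₂ (a := α s) (b := α s + r) hα0
      (fun z hz => hgap z ?_ hz.1.ne') ⟨hlt, e2⟩)
    rw [abs_lt]; constructor <;> linarith [hz.1, hz.2]

/-- Along a continuous path of isolated points, `α ε / (1 + ε v)` decreases and
`α ε / (1 - ε v)` increases. -/
theorem Admissible.path_bounds (h : Admissible B T v) {s t : ℝ} (hs : 0 ≤ s) (hst : s ≤ t)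
    (ht : t ≤ 1) {α : ℝ → ℝ} (hα : ContinuousOn α (Icc s t))
    (hiso : ∀ ε ∈ Ico s t, IsIsolatedPoint (1 + (ε : ℂ) • B) T (α ε)) :
    (1 - t * v) * α s ≤ (1 - s * v) * α t ∧ (1 + s * v) * α t ≤ (1 + t * v) * α s := by
  have hv := h.v_nonneg
  have hv1 := h.v_lt_one
  have hm : ∀ x ∈ Icc s t, 0 < 1 - x * v := fun x hx => by nlinarith [hx.1, hx.2]
  have hp : ∀ x ∈ Icc s t, 0 < 1 + x * v := fun x hx => by nlinarith [hx.1, hx.2]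
  have hloc : ∀ x ∈ Ico s t, ∀ᶠ ε in 𝓝[>] x, (1 - ε * v) / (1 - x * v) * α x ≤ α ε ∧
      α ε ≤ (1 + ε * v) / (1 + x * v) * α x := fun x hx =>
    h.eventually_mem_Icc ⟨hs.trans hx.1, hx.2.le.trans ht⟩ hx.2
      (hα.mono (Icc_subset_Icc_left hx.1)) (hiso x hx)
      fun ε hε => not_isUnit_of_ker_ne_bot (hiso ε ⟨hx.1.trans hε.1, hε.2⟩).1
  have hS := left_mem_Icc.2 hst
  have hT := right_mem_Icc.2 hst
  constructor
  · have := apply_le_of_eventually_le (f := fun x => -(α x / (1 - x * v))) hst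
      (hα.div (by fun_prop) fun x hx => (hm x hx).ne').neg (fun x hx => by
        filter_upwards [hloc x hx, Ioo_mem_nhdsGT hx.2] with ε h1 h2
        have hε := hm ε ⟨hx.1.trans h2.1.le, h2.2.le⟩
        rw [neg_le_neg_iff, le_div_iff₀ hε]
        refine le_trans (le_of_eq ?_) h1.1
        ring)
    rw [neg_le_neg_iff, div_le_div_iff₀ (hm s hS) (hm t hT)] at this
    linarith
  · have := apply_le_of_eventually_le (f := fun x => α x / (1 + x * v)) hst
      (hα.div (by fun_prop) fun x hx => (hp x hx).ne') (fun x hx => by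
        filter_upwards [hloc x hx, Ioo_mem_nhdsGT hx.2] with ε h1 h2
        have hε := hp ε ⟨hx.1.trans h2.1.le, h2.2.le⟩
        rw [div_le_iff₀ hε]
        refine le_trans h1.2 (le_of_eq ?_)
        ring)
    rw [div_le_div_iff₀ (hp t hT) (hp s hS)] at this
    linarith

/-- The spectral points of the whole family form a closed set: a limit of spectral points along a
path is spectral. -/
theorem isClosed_setOf_not_isUnit (B T : E →L[ℂ] E) :
    IsClosed {p : ℝ × ℝ | ¬ IsUnit (1 + (p.1 : ℂ) • B - (p.2 : ℂ) • T)} := by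
  have : IsOpen {p : ℝ × ℝ | IsUnit (1 + (p.1 : ℂ) • B - (p.2 : ℂ) • T)} :=
    Units.isOpen.preimage (f := fun p : ℝ × ℝ => 1 + (p.1 : ℂ) • B - (p.2 : ℂ) • T) (by fun_prop)
  exact this.isClosed_compl

end Family

/-! ### Continuation of discrete points -/

section Continuation

variable {E : Type*} [NormedAddCommGroup E] [InnerProductSpace ℂ E] [CompleteSpace E]
variable {B T : E →L[ℂ] E} {v : ℝ}

/-- A discrete point can be continued to the right, by the largest spectral point of the pencil in
a window around it. -/
theorem Admissible.exists_local_continuation (h : Admissible B T v) {s α₀ : ℝ}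
    (hs : s ∈ Ico (0 : ℝ) 1) (hd : IsDiscretePoint (1 + (s : ℂ) • B) T α₀) :
    ∃ δ > 0, s + δ ≤ 1 ∧ ∃ β : ℝ → ℝ, ContinuousOn β (Icc s (s + δ)) ∧ β s = α₀ ∧
      ∀ ε ∈ Icc s (s + δ), IsDiscretePoint (1 + (ε : ℂ) • B) T (β ε) := by
  have hv := h.v_nonneg
  have hv1 := h.v_lt_one
  have hs' : s ∈ Icc (0 : ℝ) 1 := ⟨hs.1, hs.2.le⟩
  have hns : ¬ IsUnit (1 + (s : ℂ) • B - (α₀ : ℂ) • T) := not_isUnit_of_ker_ne_bot hd.1.1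
  have hα0 : 0 < α₀ := h.pos_of_not_isUnit hs' hns
  obtain ⟨⟨-, δ₀, hδ₀, hunit⟩, hfin⟩ := hd
  -- nested windows `(α₀ - r, α₀ + r)` and `[a, b]` around `α₀`
  set r := min (δ₀ / 2) (α₀ / 2) with hr
  have hr0 : 0 < r := lt_min (by linarith) (by linarith)
  have hrδ : r < δ₀ := (min_le_left _ _).trans_lt (by linarith)
  have hrα : r < α₀ := (min_le_right _ _).trans_lt (by linarith)
  have hgap : ∀ z : ℝ, |z - α₀| < r → z ≠ α₀ → IsUnit (1 + (s : ℂ) • B - (z : ℂ) • T) := by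
    intro z hz hne
    refine hunit z (by exact_mod_cast hne) ?_
    rw [← Complex.ofReal_sub, Complex.norm_real]
    exact hz.trans hrδ
  obtain ⟨a, ha⟩ : ∃ a, a = α₀ - r / 2 := ⟨_, rfl⟩
  obtain ⟨b, hb⟩ : ∃ b, b = α₀ + r / 2 := ⟨_, rfl⟩
  have ha0 : 0 < a := by linarith
  -- `(1 - κ d) L ≤ L' ≤ (1 + κ d) L` for members of the family at parameters at distance `d`
  set κ := v / (1 - v) with hκ
  have hv1' : 0 < 1 - v := by linarith
  have hκ0 : 0 ≤ κ := by positivity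
  have hκv : v + κ * v = κ := by rw [hκ]; field_simp; ring
  have hcomp : ∀ x ∈ Icc (0 : ℝ) 1, ∀ y ∈ Icc (0 : ℝ) 1, ∀ d, |x - y| ≤ d →
      |y - (1 - κ * d) * x| * v ≤ 1 - (1 - κ * d) ∧
      |y - (1 + κ * d) * x| * v ≤ (1 + κ * d) - 1 := by
    intro x hx y hy d hxy
    have hd0 : 0 ≤ d := (abs_nonneg _).trans hxy
    have hκd : 0 ≤ κ * d := by positivity
    rw [abs_le] at hxy
    have key : (d + κ * d) * v = κ * d := by
      calc (d + κ * d) * v = (v + κ * v) * d := by ring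
        _ = κ * d := by rw [hκv]
    have hx1 : κ * d * x ≤ κ * d := mul_le_of_le_one_right hκd hx.2
    have hx0 : 0 ≤ κ * d * x := mul_nonneg hκd hx.1
    have b1 : |y - (1 - κ * d) * x| ≤ d + κ * d := by
      rw [abs_le]; constructor <;> nlinarith
    have b2 : |y - (1 + κ * d) * x| ≤ d + κ * d := by
      rw [abs_le]; constructor <;> nlinarith
    have b1' := mul_le_mul_of_nonneg_right b1 hv
    have b2' := mul_le_mul_of_nonneg_right b2 hv
    constructor <;> linarith
  obtain ⟨η, hη, hsmall⟩ : ∃ η > 0, ∀ d : ℝ, 0 ≤ d → d < η → 0 < 1 - κ * d ∧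
      (1 + κ * d) * (α₀ - r) < a ∧ b < (1 - κ * d) * (α₀ + r) ∧ a < (1 - κ * d) * α₀ ∧
      (1 + κ * d) * α₀ < (1 - κ * d) * b ∧ (1 + κ * d) * a < α₀ := by
    have hev : ∀ f g : ℝ → ℝ, Continuous f → Continuous g → f 0 < g 0 →
        ∀ᶠ d in 𝓝 (0 : ℝ), f d < g d := fun f g hf hg h0 =>
      (hf.tendsto 0).eventually_lt (hg.tendsto 0) h0
    have e := (hev (fun _ => 0) (fun d => 1 - κ * d) (by fun_prop) (by fun_prop) (by simp)).and
      ((hev (fun d => (1 + κ * d) * (α₀ - r)) (fun _ => a) (by fun_prop) (by fun_prop)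
        (by simp; linarith)).and
      ((hev (fun _ => b) (fun d => (1 - κ * d) * (α₀ + r)) (by fun_prop) (by fun_prop)
        (by simp; linarith)).and
      ((hev (fun _ => a) (fun d => (1 - κ * d) * α₀) (by fun_prop) (by fun_prop)
        (by simp; linarith)).and
      ((hev (fun d => (1 + κ * d) * α₀) (fun d => (1 - κ * d) * b) (by fun_prop) (by fun_prop)
        (by simp; linarith)).and
      (hev (fun d => (1 + κ * d) * a) (fun _ => α₀) (by fun_prop) (by fun_prop)
        (by simp; linarith))))))
    obtain ⟨η, hη, hball⟩ := Metric.eventually_nhds_iff.1 e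
    exact ⟨η, hη, fun d hd0 hd => hball (by rwa [Real.dist_eq, sub_zero, abs_of_nonneg hd0])⟩
  obtain ⟨δ, hδ⟩ : ∃ δ, δ = min (η / 2) (1 - s) := ⟨_, rfl⟩
  have hδ0 : 0 < δ := by rw [hδ]; exact lt_min (by linarith) (by linarith [hs.2])
  have hδη : δ < η := by rw [hδ]; exact (min_le_left _ _).trans_lt (by linarith)
  have hδs : s + δ ≤ 1 := by
    have : δ ≤ 1 - s := by rw [hδ]; exact min_le_right _ _
    linarith
  have hI : ∀ ε ∈ Icc s (s + δ), ε ∈ Icc (0 : ℝ) 1 := fun ε hε =>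
    ⟨hs.1.trans hε.1, hε.2.trans hδs⟩
  obtain ⟨hpos, hc1, hc2, hc3, hc4, hc5⟩ := hsmall δ hδ0.le hδη
  set S : ℝ → Set ℝ := fun ε => Icc a b ∩ {z | ¬ IsUnit (1 + (ε : ℂ) • B - (z : ℂ) • T)} with hS
  have hScompact : ∀ ε, IsCompact (S ε) := fun ε =>
    isCompact_Icc.inter_right ((isClosed_setOf_not_isUnit B T).preimage
      (f := fun z : ℝ => (ε, z)) (by fun_prop))
  have hSbound : ∀ ε ∈ Icc s (s + δ), ∀ z ∈ S ε,
      (1 - κ * (ε - s)) * α₀ ≤ z ∧ z ≤ (1 + κ * (ε - s)) * α₀ := by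
    intro ε hε z hz
    have hd0 : 0 ≤ ε - s := sub_nonneg.2 hε.1
    obtain ⟨k0, k1, k2, k3, k4, k5⟩ := hsmall (ε - s) hd0 (by linarith [hε.2])
    obtain ⟨g1, g2⟩ := hcomp s hs' ε (hI ε hε) (ε - s) (by rw [abs_sub_comm, abs_of_nonneg hd0])
    constructor
    · by_contra! hlt
      refine hz.2 (h.isUnit_of_gap hs' k0 g1 g2 (a := α₀ - r) (b := α₀) (by linarith)
        (fun z hz => hgap z ?_ hz.2.ne) ⟨k1.trans_le hz.1.1, hlt⟩)
      rw [abs_lt]; constructor <;> linarith [hz.1, hz.2]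
    · by_contra! hlt
      refine hz.2 (h.isUnit_of_gap hs' k0 g1 g2 (a := α₀) (b := α₀ + r) hα0
        (fun z hz => hgap z ?_ hz.1.ne') ⟨hlt, hz.1.2.trans_lt k2⟩)
      rw [abs_lt]; constructor <;> linarith [hz.1, hz.2]
  -- if the window had no spectrum at `ε`, then `α₀` would not be spectral at `s`
  have hSne : ∀ ε ∈ Icc s (s + δ), (S ε).Nonempty := by
    intro ε hε
    have hd0 : 0 ≤ ε - s := sub_nonneg.2 hε.1
    obtain ⟨k0, k1, k2, k3, k4, k5⟩ := hsmall (ε - s) hd0 (by linarith [hε.2])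
    obtain ⟨g1, g2⟩ := hcomp ε (hI ε hε) s hs' (ε - s) (by rw [abs_of_nonneg hd0])
    by_contra hemp
    refine hns (h.isUnit_of_gap (hI ε hε) k0 g1 g2 (a := a) (b := b) ha0 (fun z hz => ?_)
      ⟨k5, lt_of_le_of_lt ?_ k4⟩)
    · by_contra hz'
      exact hemp ⟨z, ⟨hz.1.le, hz.2.le⟩, hz'⟩
    · have : 0 ≤ κ * (ε - s) * α₀ := by positivity
      linarith
  have hβS : ∀ ε ∈ Icc s (s + δ), sSup (S ε) ∈ S ε := fun ε hε =>
    (hScompact ε).sSup_mem (hSne ε hε)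
  have hβub : ∀ ε, ∀ z ∈ S ε, z ≤ sSup (S ε) := fun ε z hz =>
    le_csSup (hScompact ε).bddAbove hz
  refine ⟨δ, hδ0, hδs, fun ε => sSup (S ε), ?_, ?_, ?_⟩
  · have hle : ∀ x ∈ Icc s (s + δ), ∀ y ∈ Icc s (s + δ),
        sSup (S x) ≤ (1 + κ * |x - y|) * sSup (S y) := by
      intro x hx y hy
      have hd : |x - y| ≤ δ := by
        rw [abs_le]; constructor <;> linarith [hx.1, hx.2, hy.1, hy.2]
      obtain ⟨k0, -⟩ := hsmall |x - y| (abs_nonneg _) (hd.trans_lt hδη)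
      obtain ⟨g1, g2⟩ := hcomp y (hI y hy) x (hI x hx) |x - y| (by rw [abs_sub_comm])
      by_contra! hlt
      refine (hβS x hx).2 (h.isUnit_of_gap (hI y hy) k0 g1 g2 (a := sSup (S y)) (b := b)
        (ha0.trans_le (hβS y hy).1.1) (fun z hz => ?_) ⟨hlt, ?_⟩)
      · by_contra hz'
        exact absurd (hβub y z ⟨⟨(hβS y hy).1.1.trans hz.1.le, hz.2.le⟩, hz'⟩) (not_le.2 hz.1)
      · have m1 : κ * (x - s) ≤ κ * δ := mul_le_mul_of_nonneg_left (by linarith [hx.2]) hκ0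
        have m2 : κ * |x - y| ≤ κ * δ := mul_le_mul_of_nonneg_left hd hκ0
        calc sSup (S x) ≤ (1 + κ * (x - s)) * α₀ := (hSbound x hx _ (hβS x hx)).2
          _ ≤ (1 + κ * δ) * α₀ := by gcongr
          _ < (1 - κ * δ) * b := hc4
          _ ≤ (1 - κ * |x - y|) * b :=
            mul_le_mul_of_nonneg_right (by linarith) (by linarith)
    have hlip : ∀ x ∈ Icc s (s + δ), ∀ y ∈ Icc s (s + δ),
        sSup (S x) - sSup (S y) ≤ κ * b * |x - y| := by
      intro x hx y hy
      have h1 := hle x hx y hy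
      have h2 : κ * |x - y| * sSup (S y) ≤ κ * |x - y| * b :=
        mul_le_mul_of_nonneg_left (hβS y hy).1.2 (by positivity)
      nlinarith
    have hκb : 0 ≤ κ * b := mul_nonneg hκ0 (by linarith)
    refine (LipschitzOnWith.of_dist_le_mul (K := ⟨κ * b, hκb⟩) fun x hx y hy => ?_).continuousOn
    rw [Real.dist_eq, Real.dist_eq, abs_sub_le_iff]
    refine ⟨hlip x hx y hy, ?_⟩
    rw [abs_sub_comm]
    exact hlip y hy x hx
  · have hmem : s ∈ Icc s (s + δ) := left_mem_Icc.2 (by linarith)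
    have := hSbound s hmem _ (hβS s hmem)
    simp only [sub_self, mul_zero, sub_zero, add_zero, one_mul] at this
    exact le_antisymm this.2 this.1
  · intro ε hε
    have hd0 : 0 ≤ ε - s := sub_nonneg.2 hε.1
    obtain ⟨k0, k1, k2, k3, k4, k5⟩ := hsmall (ε - s) hd0 (by linarith [hε.2])
    obtain ⟨g1, g2⟩ := hcomp s hs' ε (hI ε hε) (ε - s) (by rw [abs_sub_comm, abs_of_nonneg hd0])
    have hβ := hβS ε hε
    refine isDiscretePoint_of_isFredholmZero (h.isStrictlyPositive (hI ε hε))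
      h.nonneg.isSelfAdjoint (ha0.trans_le hβ.1.1) ?_ hβ.2
    refine h.isFredholmZero_of_isolated hs' k0 g1 g2 (a := α₀ - r) (b := α₀ + r) (z₀ := α₀)
      (by linarith) ⟨by linarith, by linarith⟩ (fun z hz hne => hgap z ?_ hne) hfin
      ⟨k1.trans_le hβ.1.1, hβ.1.2.trans_lt k2⟩
    rw [abs_lt]; constructor <;> linarith [hz.1, hz.2]

/-- `μ` follows the discrete point `α₀` of the pencil at `ε = 0` along the interval `[0, t]`. -/
def IsContinuation (B T : E →L[ℂ] E) (α₀ t : ℝ) (μ : ℝ → ℝ) : Prop :=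
  t ∈ Icc (0 : ℝ) 1 ∧ ContinuousOn μ (Icc 0 t) ∧ μ 0 = α₀ ∧
    ∀ ε ∈ Icc 0 t, IsDiscretePoint (1 + (ε : ℂ) • B) T (μ ε)

/-- The shift bound: `path_bounds` between `0` and `t`. -/
theorem Admissible.path_dist_le (h : Admissible B T v) {t : ℝ} (ht : t ∈ Icc (0 : ℝ) 1)
    {μ : ℝ → ℝ} (hμ : ContinuousOn μ (Icc 0 t))
    (hiso : ∀ ε ∈ Ico 0 t, IsIsolatedPoint (1 + (ε : ℂ) • B) T (μ ε)) :
    |μ t - μ 0| ≤ t * v * μ 0 := by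
  obtain ⟨h1, h2⟩ := h.path_bounds le_rfl ht.1 ht.2 hμ hiso
  rw [abs_le]
  constructor <;> nlinarith

/-- Continuations are Lipschitz with a constant that does not depend on `t`, so that a continuation
on a half-open interval extends to the endpoint. -/
theorem Admissible.path_lipschitz (h : Admissible B T v) {α₀ t : ℝ} {μ : ℝ → ℝ}
    (hμ : IsContinuation B T α₀ t μ) {x y : ℝ} (hx : 0 ≤ x) (hxy : x ≤ y) (hy : y ≤ t) :
    |μ y - μ x| ≤ 2 * v * α₀ / (1 - v) * |y - x| := by
  have hv := h.v_nonneg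
  have hv1 : 0 < 1 - v := by linarith [h.v_lt_one]
  obtain ⟨ht, hc, h0, hd⟩ := hμ
  have hpath : ∀ a b : ℝ, 0 ≤ a → a ≤ b → b ≤ t →
      (1 - b * v) * μ a ≤ (1 - a * v) * μ b ∧ (1 + a * v) * μ b ≤ (1 + b * v) * μ a :=
    fun a b ha hab hb => h.path_bounds ha hab (hb.trans ht.2)
      (hc.mono (Icc_subset_Icc ha hb)) fun ε hε => (hd ε ⟨ha.trans hε.1, hε.2.le.trans hb⟩).1
  have hpos : ∀ a ∈ Icc 0 t, 0 < μ a := fun a ha => h.pos_of_not_isUnit ⟨ha.1, ha.2.trans ht.2⟩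
    (not_isUnit_of_ker_ne_bot (hd a ha).1.1)
  have hα0 : 0 < α₀ := h0 ▸ hpos 0 (left_mem_Icc.2 ht.1)
  have hμx : 0 < μ x := hpos x ⟨hx, hxy.trans hy⟩
  have hμy : 0 < μ y := hpos y ⟨hx.trans hxy, hy⟩
  have hx1 : x ≤ 1 := (hxy.trans hy).trans ht.2
  have hle : μ x ≤ 2 * α₀ := by
    have h1 := (hpath 0 x le_rfl hx (hxy.trans hy)).2
    rw [h0, zero_mul, add_zero, one_mul] at h1
    have : x * v ≤ 1 := by nlinarith [h.v_lt_one]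
    nlinarith
  obtain ⟨h1, h2⟩ := hpath x y hx hxy hy
  have hxv : x * v ≤ v := mul_le_of_le_one_left hv hx1
  have hxv0 : 0 ≤ x * v := mul_nonneg hx hv
  have hd0 : 0 ≤ y - x := sub_nonneg.2 hxy
  have hvd : 0 ≤ (y - x) * v := mul_nonneg hd0 hv
  have e1 : (1 - v) * (μ y - μ x) ≤ (y - x) * v * (2 * α₀) := by
    have a1 : (1 + x * v) * (μ y - μ x) ≤ (y - x) * v * μ x := by linarith
    have a2 := mul_le_mul_of_nonneg_left hle hvd
    rcases le_total 0 (μ y - μ x) with hh | hh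
    · have := mul_le_mul_of_nonneg_right (show 1 - v ≤ 1 + x * v by linarith) hh
      linarith
    · have := mul_nonneg hvd hα0.le
      have := mul_nonneg hv1.le (neg_nonneg.2 hh)
      linarith
  have e2 : (1 - v) * (μ x - μ y) ≤ (y - x) * v * (2 * α₀) := by
    have a1 : (1 - x * v) * (μ x - μ y) ≤ (y - x) * v * μ x := by linarith
    have a2 := mul_le_mul_of_nonneg_left hle hvd
    rcases le_total 0 (μ x - μ y) with hh | hh
    · have := mul_le_mul_of_nonneg_right (show 1 - v ≤ 1 - x * v by linarith) hh
      linarith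
    · have := mul_nonneg hvd hα0.le
      have := mul_nonneg hv1.le (neg_nonneg.2 hh)
      linarith
  rw [abs_of_nonneg hd0, div_mul_eq_mul_div, le_div_iff₀ hv1]
  rcases abs_cases (μ y - μ x) with ⟨e, -⟩ | ⟨e, -⟩ <;> rw [e] <;> linarith

/-- A discrete point at `ε = 0` can be followed up to `ε = 1`, or up to a parameter at which the
path runs into a spectral point that is not discrete. -/
theorem Admissible.exists_continuation (h : Admissible B T v) {α₀ : ℝ}
    (hd : IsDiscretePoint (1 + ((0 : ℝ) : ℂ) • B) T α₀) :
    ∃ t : ℝ, 0 < t ∧ t ≤ 1 ∧ ∃ μ : ℝ → ℝ, ContinuousOn μ (Icc 0 t) ∧ μ 0 = α₀ ∧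
      (∀ ε ∈ Ico 0 t, IsDiscretePoint (1 + (ε : ℂ) • B) T (μ ε)) ∧
      ((t = 1 ∧ IsDiscretePoint (1 + ((1 : ℝ) : ℂ) • B) T (μ 1)) ∨
        (¬ IsUnit (1 + (t : ℂ) • B - (μ t : ℂ) • T) ∧
          ¬ IsDiscretePoint (1 + (t : ℂ) • B) T (μ t))) := by
  let P := {p : ℝ × (ℝ → ℝ) // IsContinuation B T α₀ p.1 p.2}
  let R : P → P → Prop := fun p q => p.1.1 ≤ q.1.1 ∧ EqOn p.1.2 q.1.2 (Icc 0 p.1.1)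
  have hRrefl : ∀ p, R p p := fun p => ⟨le_rfl, fun x _ => rfl⟩
  have hRtrans : ∀ {p q w}, R p q → R q w → R p w := fun {p q w} h1 h2 =>
    ⟨h1.1.trans h2.1, fun x hx => (h1.2 hx).trans (h2.2 ⟨hx.1, hx.2.trans h1.1⟩)⟩
  let p₀ : P := ⟨(0, fun _ => α₀), ⟨le_rfl, zero_le_one⟩, continuousOn_const, rfl, fun ε hε => by
    have : ε = 0 := le_antisymm hε.2 hε.1
    subst this
    exact hd⟩
  by_cases hchain : ∀ c : Set P, IsChain R c → ∃ ub, ∀ p ∈ c, R p ub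
  · -- a maximal continuation exists, and it reaches `ε = 1`
    obtain ⟨⟨⟨t, μ⟩, ht, hc, h0, hdisc⟩, hmax⟩ := exists_maximal_of_chains_bounded hchain hRtrans
    simp only at ht hc h0 hdisc
    have ht1 : t = 1 := by
      by_contra hne
      have htlt : t < 1 := lt_of_le_of_ne ht.2 hne
      obtain ⟨δ, hδ, hδ1, β, hβc, hβt, hβd⟩ := h.exists_local_continuation ⟨ht.1, htlt⟩
        (hdisc t (right_mem_Icc.2 ht.1))
      let ν : ℝ → ℝ := fun x => if x ≤ t then μ x else β x
      have e1 : EqOn ν μ (Icc 0 t) := fun x hx => if_pos hx.2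
      have e2 : EqOn ν β (Icc t (t + δ)) := fun x hx => by
        rcases eq_or_lt_of_le hx.1 with rfl | hlt
        · simp [ν, hβt]
        · simp [ν, not_le.2 hlt]
      have hU : Icc 0 t ∪ Icc t (t + δ) = Icc 0 (t + δ) := Icc_union_Icc_eq_Icc ht.1 (by linarith)
      have hν : IsContinuation B T α₀ (t + δ) ν := by
        refine ⟨⟨by linarith [ht.1], hδ1⟩, ?_, ?_, ?_⟩
        · rw [← hU]
          exact (hc.congr e1).union_of_isClosed (hβc.congr e2) isClosed_Icc isClosed_Icc
        · rw [e1 (left_mem_Icc.2 ht.1), h0]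
        · intro ε hε
          rw [← hU] at hε
          rcases hε with hε | hε
          · rw [e1 hε]; exact hdisc ε hε
          · rw [e2 hε]; exact hβd ε hε
      have := (hmax ⟨(t + δ, ν), hν⟩ ⟨by simp; linarith, fun x hx => (e1 hx).symm⟩).1
      simp only at this
      linarith
    subst ht1
    exact ⟨1, one_pos, le_rfl, μ, hc, h0, fun ε hε => hdisc ε ⟨hε.1, hε.2.le⟩,
      Or.inl ⟨rfl, hdisc 1 (right_mem_Icc.2 zero_le_one)⟩⟩
  · -- the union of an unbounded chain of continuations ends at a point that is not discrete
    push Not at hchain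
    obtain ⟨c, hc, hub⟩ := hchain
    have hagree : ∀ p ∈ c, ∀ q ∈ c, ∀ x, 0 ≤ x → x ≤ p.1.1 → x ≤ q.1.1 → p.1.2 x = q.1.2 x := by
      intro p hp q hq x hx hxp hxq
      by_cases hpq : p = q
      · rw [hpq]
      · rcases hc hp hq hpq with hr | hr
        · exact hr.2 ⟨hx, hxp⟩
        · exact (hr.2 ⟨hx, hxq⟩).symm
    obtain ⟨p₁, hp₁, -⟩ := hub p₀
    set t := sSup ((fun p : P => p.1.1) '' c) with ht
    have hbdd : BddAbove ((fun p : P => p.1.1) '' c) :=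
      ⟨1, by rintro _ ⟨p, -, rfl⟩; exact p.2.1.2⟩
    have hle : ∀ p ∈ c, p.1.1 ≤ t := fun p hp => le_csSup hbdd ⟨p, hp, rfl⟩
    have hlt : ∀ p ∈ c, p.1.1 < t := by
      intro p hp
      refine lt_of_le_of_ne (hle p hp) fun heq => ?_
      obtain ⟨q, hq, hqn⟩ := hub p
      exact hqn ⟨heq ▸ hle q hq, fun x hx =>
        hagree q hq p hp x hx.1 hx.2 (hx.2.trans (heq ▸ hle q hq))⟩
    have ht0 : 0 < t := p₁.2.1.1.trans_lt (hlt p₁ hp₁)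
    have ht1 : t ≤ 1 := csSup_le ⟨_, p₁, hp₁, rfl⟩ (by rintro _ ⟨p, -, rfl⟩; exact p.2.1.2)
    have hex : ∀ x : ℝ, ∃ p : P, x < t → p ∈ c ∧ x < p.1.1 := by
      intro x
      by_cases hx : x < t
      · obtain ⟨_, ⟨p, hp, rfl⟩, hxp⟩ := exists_lt_of_lt_csSup (Set.Nonempty.image _ ⟨p₁, hp₁⟩) hx
        exact ⟨p, fun _ => ⟨hp, hxp⟩⟩
      · exact ⟨p₁, fun h => absurd h hx⟩
    choose F hF using hex
    let f : ℝ → ℝ := fun x => (F x).1.2 x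
    have hfp : ∀ p ∈ c, ∀ x, 0 ≤ x → x ≤ p.1.1 → f x = p.1.2 x := fun p hp x hx hxp =>
      have hxt := hxp.trans_lt (hlt p hp)
      hagree _ (hF x hxt).1 p hp x hx (hF x hxt).2.le hxp
    have hα0 : 0 ≤ α₀ := (h.pos_of_not_isUnit ⟨le_rfl, zero_le_one⟩
      (not_isUnit_of_ker_ne_bot hd.1.1)).le
    have hv1 : 0 < 1 - v := by linarith [h.v_lt_one]
    have hK : 0 ≤ 2 * v * α₀ / (1 - v) :=
      div_nonneg (mul_nonneg (mul_nonneg zero_le_two h.v_nonneg) hα0) hv1.le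
    have hflip : ∀ x ∈ Ico 0 t, ∀ y ∈ Ico 0 t, x ≤ y →
        |f y - f x| ≤ 2 * v * α₀ / (1 - v) * |y - x| := by
      intro x hx y hy hxy
      obtain ⟨hp, hyp⟩ := hF y hy.2
      rw [hfp _ hp x hx.1 (hxy.trans hyp.le), hfp _ hp y hy.1 hyp.le]
      exact h.path_lipschitz (F y).2 hx.1 hxy hyp.le
    have hLip : LipschitzOnWith (⟨2 * v * α₀ / (1 - v), hK⟩ : NNReal) f (Ico 0 t) := by
      refine LipschitzOnWith.of_dist_le_mul fun x hx y hy => ?_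
      rw [Real.dist_eq, Real.dist_eq]
      rcases le_total x y with hxy | hxy
      · rw [abs_sub_comm, abs_sub_comm x]
        exact hflip x hx y hy hxy
      · exact hflip y hy x hx hxy
    obtain ⟨μ, hμLip, hμf⟩ := hLip.extend_real
    have hμc : Continuous μ := hμLip.continuous
    have hμp : ∀ p ∈ c, ∀ x, 0 ≤ x → x ≤ p.1.1 → μ x = p.1.2 x := fun p hp x hx hxp =>
      (hμf ⟨hx, hxp.trans_lt (hlt p hp)⟩).symm.trans (hfp p hp x hx hxp)
    have hμ0 : μ 0 = α₀ := (hμp p₁ hp₁ 0 le_rfl p₁.2.1.1).trans p₁.2.2.2.1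
    have hμd : ∀ ε ∈ Ico 0 t, IsDiscretePoint (1 + (ε : ℂ) • B) T (μ ε) := by
      intro ε hε
      obtain ⟨hp, hεp⟩ := hF ε hε.2
      rw [hμp _ hp ε hε.1 hεp.le]
      exact (F ε).2.2.2.2 ε ⟨hε.1, hεp.le⟩
    refine ⟨t, ht0, ht1, μ, hμc.continuousOn, hμ0, hμd, Or.inr ⟨?_, fun hdt => ?_⟩⟩
    · have hmem : (fun x => (x, μ x)) t ∈
          {p : ℝ × ℝ | ¬ IsUnit (1 + (p.1 : ℂ) • B - (p.2 : ℂ) • T)} := by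
        refine (isClosed_setOf_not_isUnit B T).mem_of_tendsto (b := 𝓝[<] t)
          (f := fun x => (x, μ x)) ?_ ?_
        · exact ((continuous_id.prodMk hμc).tendsto t).mono_left nhdsWithin_le_nhds
        · filter_upwards [Ioo_mem_nhdsLT ht0] with x hx
          exact not_isUnit_of_ker_ne_bot (hμd x ⟨hx.1.le, hx.2⟩).1.1
      exact hmem
    · have hgood : IsContinuation B T α₀ t μ := by
        refine ⟨⟨ht0.le, ht1⟩, hμc.continuousOn, hμ0, fun ε hε => ?_⟩
        rcases eq_or_lt_of_le hε.2 with rfl | hlt'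
        · exact hdt
        · exact hμd ε ⟨hε.1, hlt'⟩
      obtain ⟨q, hq, hqn⟩ := hub ⟨(t, μ), hgood⟩
      exact hqn ⟨hle q hq, fun x hx => (hμp q hq x hx.1 hx.2).symm⟩

end Continuation

end HermitianPencil

noncomputable section

namespace EigenvalueShift

open HermitianPencil

/-! ### Unbounded operators and pencils -/

section Correspondence

variable {E : Type*} [NormedAddCommGroup E] [InnerProductSpace ℂ E]

/-- `A + 1 = S⁻¹ L S⁻¹`, expressed through the graph of `A`, as `S` has no bounded inverse in
general. -/
def IsFactored (A : E →ₗ.[ℂ] E) (S L : E →L[ℂ] E) : Prop :=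
  ∀ u f : E, (u, f) ∈ A.graph ↔ ∃ y, S y = u ∧ L y = S (f + u)

variable {A : E →ₗ.[ℂ] E} {S L : E →L[ℂ] E}

/-- In one direction, the resolvent of `A` at `z - 1` is `S (L - z S²)⁻¹ S`. In the other,
`(A + 1)⁻¹ = S L⁻¹ S` gives the invertibility of `1 - z S L⁻¹ S`, and `1 - x y` is invertible along
with `1 - y x`. -/
theorem IsFactored.mem_resolventSet_iff (hA : IsFactored A S L) (hL : IsUnit L) (z : ℂ) :
    z - 1 ∈ resolventSet A ↔ IsUnit (L - z • (S * S)) := by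
  obtain ⟨g, rfl⟩ := hL
  have hg : ∀ x y : E, (g : E →L[ℂ] E) x = y ↔ x = (↑g⁻¹ : E →L[ℂ] E) y := by
    intro x y
    constructor
    · rintro rfl
      rw [← mul_apply_eq_comp, Units.inv_mul, one_apply_eq_self]
    · rintro rfl
      rw [← mul_apply_eq_comp, Units.mul_inv, one_apply_eq_self]
  constructor
  · rintro ⟨R, hR1, hR2⟩
    -- `1 + z R` is the inverse of `1 - z (A + 1)⁻¹`
    set Q : E →L[ℂ] E := S * ↑g⁻¹ * S with hQ
    have h1 : ∀ x, R x = Q (x + z • R x) := by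
      intro x
      obtain ⟨hx, hx'⟩ := hR1 x
      have hmem : (R x, x + (z - 1) • R x) ∈ A.graph := by
        rw [LinearPMap.mem_graph_iff]
        exact ⟨⟨R x, hx⟩, rfl, sub_eq_iff_eq_add.1 hx'⟩
      obtain ⟨y, hy1, hy2⟩ := (hA _ _).1 hmem
      rw [hg] at hy2
      have e : x + (z - 1) • R x + R x = x + z • R x := by module
      rw [e] at hy2
      exact hy1.symm.trans (congrArg S hy2)
    have h2 : ∀ x, R (x - z • Q x) = Q x := by
      intro x
      have hmem : (Q x, x - Q x) ∈ A.graph := by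
        refine (hA _ _).2 ⟨(↑g⁻¹ : E →L[ℂ] E) (S x), rfl, ?_⟩
        rw [hg, sub_add_cancel]
      obtain ⟨u, hu1, hu2⟩ := LinearPMap.mem_graph_iff _ |>.1 hmem
      simp only at hu1 hu2
      have := hR2 u
      rw [hu1, hu2] at this
      rw [← this]
      nth_rewrite 1 [this]
      congr 1
      module
    have hu : IsUnit (1 - S * (z • (↑g⁻¹ * S))) := by
      have e : S * (z • ((↑g⁻¹ : E →L[ℂ] E) * S)) = z • Q := by rw [mul_smul_comm, hQ, mul_assoc]
      rw [e]
      refine ⟨⟨1 - z • Q, 1 + z • R, ?_, ?_⟩, rfl⟩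
      · ext x
        have h := h1 x
        have : (x + z • R x) - z • Q (x + z • R x) = x := by rw [← h]; abel
        simpa using this
      · ext x
        have : (x - z • Q x) + z • R (x - z • Q x) = x := by rw [h2]; abel
        simpa using this
    have hu' : IsUnit (1 - (z • ((↑g⁻¹ : E →L[ℂ] E) * S)) * S) := by
      have := _root_.spectrum.unit_mem_mul_comm (R := ℂ) (a := S)
        (b := z • ((↑g⁻¹ : E →L[ℂ] E) * S)) (r := 1)
      simp only [_root_.spectrum.mem_iff, Units.val_one, map_one, not_iff_not] at this
      exact this.1 hu
    have e : (g : E →L[ℂ] E) - z • (S * S) = g * (1 - (z • ((↑g⁻¹ : E →L[ℂ] E) * S)) * S) := by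
      rw [mul_sub, mul_one, smul_mul_assoc, mul_smul_comm, mul_assoc, Units.mul_inv_cancel_left]
    rw [e]
    exact g.isUnit.mul hu'
  · rintro ⟨w, hw⟩
    have hw1 : ∀ x, (g : E →L[ℂ] E) ((↑w⁻¹ : E →L[ℂ] E) x) =
        x + z • S (S ((↑w⁻¹ : E →L[ℂ] E) x)) := by
      intro x
      have h : (w : E →L[ℂ] E) ((↑w⁻¹ : E →L[ℂ] E) x) = x := by
        rw [← mul_apply_eq_comp, Units.mul_inv, one_apply_eq_self]
      rw [hw] at h
      nth_rewrite 2 [← h]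
      simp
    have hw2 : ∀ x, (↑w⁻¹ : E →L[ℂ] E) ((g : E →L[ℂ] E) x - z • S (S x)) = x := by
      intro x
      have h : (↑w⁻¹ : E →L[ℂ] E) ((w : E →L[ℂ] E) x) = x := by
        rw [← mul_apply_eq_comp, Units.inv_mul, one_apply_eq_self]
      rw [hw] at h
      simpa using h
    refine ⟨S * ↑w⁻¹ * S, fun x => ?_, fun u => ?_⟩
    · have hmem : ((S * ↑w⁻¹ * S) x, x + (z - 1) • (S * ↑w⁻¹ * S) x) ∈ A.graph := by
        refine (hA _ _).2 ⟨(↑w⁻¹ : E →L[ℂ] E) (S x), rfl, ?_⟩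
        rw [hw1, add_assoc, sub_smul, one_smul, sub_add_cancel, map_add, map_smul]
        rfl
      obtain ⟨u, hu1, hu2⟩ := LinearPMap.mem_graph_iff _ |>.1 hmem
      simp only at hu1 hu2
      rw [← hu1]
      refine ⟨u.2, ?_⟩
      rw [hu2, ← hu1]
      abel
    · obtain ⟨y, hy1, hy2⟩ := (hA _ _).1 (A.mem_graph u)
      have h := hw2 y
      rw [hy2, hy1, ← map_smul, ← map_sub] at h
      have e : A u - (z - 1) • (u : E) = A u + u - z • (u : E) := by module
      rw [← e] at h
      exact (congrArg S h).trans hy1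

theorem IsFactored.eigenspace_eq (hA : IsFactored A S L) (z : ℂ) :
    eigenspace A (z - 1) = (L - z • (S * S)).ker.map S.toLinearMap := by
  ext u
  have h1 : u ∈ eigenspace A (z - 1) ↔ (u, (z - 1) • u) ∈ A.graph := by
    rw [LinearPMap.mem_graph_iff, eigenspace, Submodule.mem_map]
    refine exists_congr fun w => ?_
    rw [LinearMap.mem_ker]
    constructor
    · rintro ⟨h, rfl⟩
      exact ⟨rfl, sub_eq_zero.1 h⟩
    · rintro ⟨h, h'⟩
      simp only at h h'
      subst h
      exact ⟨sub_eq_zero.2 h', rfl⟩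
  rw [h1, hA, Submodule.mem_map]
  refine exists_congr fun y => ?_
  rw [and_comm]
  refine and_congr_left fun hy => ?_
  rw [LinearMap.mem_ker, ← hy]
  change _ ↔ L y - z • S (S y) = 0
  rw [sub_eq_zero, sub_smul, one_smul, sub_add_cancel, map_smul]

theorem IsFactored.isIsolatedEigenvalue_iff (hA : IsFactored A S L) (hL : IsUnit L)
    (hS : Function.Injective S) (α : ℝ) :
    IsIsolatedEigenvalue A (α - 1) ↔ IsIsolatedPoint L (S * S) α := by
  refine and_congr ?_ ?_
  · rw [Complex.ofReal_sub, Complex.ofReal_one, hA.eigenspace_eq]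
    exact ((Submodule.map_injective_of_injective (f := S.toLinearMap) hS).eq_iff'
      (Submodule.map_bot _)).not
  · refine exists_congr fun δ => and_congr_right fun _ => ?_
    rw [Complex.ofReal_sub, Complex.ofReal_one]
    constructor
    · intro h w hw hwδ
      rw [← hA.mem_resolventSet_iff hL]
      by_contra hw'
      have := h (w - 1) hw' (fun h => hw (sub_left_injective h))
      rw [sub_sub_sub_cancel_right] at this
      linarith
    · intro h z hz hne
      by_contra! hlt
      refine hz ?_
      have := (hA.mem_resolventSet_iff hL (z + 1)).2 (h (z + 1)
        (fun h => hne (by rw [← h]; ring)) (by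
          rwa [show z + 1 - (α : ℂ) = z - ((α : ℂ) - 1) by ring]))
      rwa [add_sub_cancel_right] at this

theorem IsFactored.isDiscreteEigenvalue_iff (hA : IsFactored A S L) (hL : IsUnit L)
    (hS : Function.Injective S) (α : ℝ) :
    IsDiscreteEigenvalue A (α - 1) ↔ IsDiscretePoint L (S * S) α := by
  refine and_congr (hA.isIsolatedEigenvalue_iff hL hS α) ?_
  rw [Complex.ofReal_sub, Complex.ofReal_one, hA.eigenspace_eq]
  exact Module.Finite.equiv_iff (Submodule.equivMapOfInjective S.toLinearMap hS _).symm

end Correspondence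

/-! ### The square root of `(1 + H₀)⁻¹` -/

section HalfResolvent

variable {E : Type*} [NormedAddCommGroup E] [InnerProductSpace ℂ E] {H₀ : E →ₗ.[ℂ] E}

theorem energy_add_norm_sq (u : H₀.domain) :
    energy H₀ u + ‖(u : E)‖ ^ 2 = (inner ℂ (u : E) (H₀ u + (u : E))).re := by
  rw [inner_add_right, Complex.add_re, inner_self_eq_norm_sq_to_K, energy]
  congr 1
  norm_cast

/-- Since `1 + H₀ ≥ 1`, this bound makes the range of `1 + H₀` closed and its inverse continuous. -/
theorem norm_le_norm_add_self (h₀ : Nonneg H₀) (u : H₀.domain) :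
    ‖(u : E)‖ ≤ ‖H₀ u + (u : E)‖ := by
  have h1 := energy_add_norm_sq u
  have h2 := h₀ u
  have h3 : (inner ℂ (u : E) (H₀ u + (u : E))).re ≤ ‖(u : E)‖ * ‖H₀ u + (u : E)‖ :=
    (Complex.re_le_norm _).trans (norm_inner_le_norm _ _)
  rcases (norm_nonneg (u : E)).eq_or_lt with h | h
  · rw [← h]; exact norm_nonneg _
  · nlinarith

variable [CompleteSpace E]

theorem isFormalAdjoint_self (hsa : IsSelfAdjoint H₀) : H₀.IsFormalAdjoint H₀ := by
  have h := LinearPMap.adjoint_isFormalAdjoint (T := H₀) hsa.dense_domain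
  rwa [LinearPMap.isSelfAdjoint_def.1 hsa] at h

/-- `1 + H₀` has a bounded inverse. Its range is dense because a vector orthogonal to it lies in the
domain of the adjoint `H₀`, as an eigenvector for `-1`. -/
theorem neg_one_mem_resolventSet (hsa : IsSelfAdjoint H₀) (h₀ : Nonneg H₀) :
    (-1 : ℂ) ∈ resolventSet H₀ := by
  let K : H₀.domain →ₗ[ℂ] E := H₀.toFun + H₀.domain.subtype
  have hKa : ∀ u, K u = H₀ u + (u : E) := fun u => rfl
  have hnorm : ∀ u : H₀.domain, ‖(u : E)‖ ≤ ‖K u‖ := norm_le_norm_add_self h₀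
  have hinj : Function.Injective K := by
    rw [injective_iff_map_eq_zero]
    intro u hu
    have := hnorm u
    rw [hu, norm_zero] at this
    exact Subtype.ext (norm_le_zero_iff.1 this)
  have hclosed : IsClosed (K.range : Set E) := by
    refine IsSeqClosed.isClosed fun y x hy hx => ?_
    choose u hu using hy
    have hcau : CauchySeq fun n => (u n : E) := by
      rw [cauchySeq_iff_tendsto_dist_atTop_0]
      refine squeeze_zero (fun _ => dist_nonneg) (fun p => ?_)
        (cauchySeq_iff_tendsto_dist_atTop_0.1 hx.cauchySeq)
      have := hnorm (u p.1 - u p.2)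
      rwa [map_sub, hu, hu, ← dist_eq_norm, Submodule.coe_sub, ← dist_eq_norm] at this
    obtain ⟨w, hw⟩ := cauchySeq_tendsto_of_complete hcau
    have hlim : Tendsto (fun n => ((u n : E), H₀ (u n))) atTop (𝓝 (w, x - w)) := by
      refine hw.prodMk_nhds ((hx.sub hw).congr fun n => ?_)
      rw [← hu, hKa, add_sub_cancel_right]
    have hmem : (w, x - w) ∈ H₀.graph :=
      IsClosed.mem_of_tendsto hsa.isClosed hlim (Eventually.of_forall fun n => H₀.mem_graph (u n))
    obtain ⟨d, hd1, hd2⟩ := LinearPMap.mem_graph_iff _ |>.1 hmem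
    exact ⟨d, by rw [hKa, hd2, hd1]; exact sub_add_cancel x w⟩
  have horth : K.rangeᗮ = ⊥ := by
    refine (Submodule.eq_bot_iff _).2 fun f hf => ?_
    have hf' : ∀ u, inner ℂ (H₀ u + (u : E)) f = 0 := fun u => hf _ ⟨u, rfl⟩
    -- `f` is orthogonal to the range, so it lies in the domain of the adjoint
    have hfd : f ∈ H₀.domain := by
      have h := LinearPMap.mem_adjoint_domain_of_exists (T := H₀) f ⟨-f, fun x => by
        have h1 := hf' x
        rw [← inner_conj_symm, map_eq_zero, inner_add_right] at h1
        rw [inner_neg_left]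
        exact (eq_neg_of_add_eq_zero_left h1).symm⟩
      rwa [LinearPMap.isSelfAdjoint_def.1 hsa] at h
    have h1 := hf' ⟨f, hfd⟩
    rw [← inner_conj_symm, map_eq_zero] at h1
    have h2 := energy_add_norm_sq (⟨f, hfd⟩ : H₀.domain)
    rw [h1, Complex.zero_re] at h2
    have h3 := h₀ ⟨f, hfd⟩
    have h4 : ‖f‖ ^ 2 ≤ 0 := by linarith
    exact norm_eq_zero.1 (pow_eq_zero_iff two_ne_zero |>.1 (le_antisymm h4 (sq_nonneg _)))
  have hsurj : Function.Surjective K := by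
    rw [← LinearMap.range_eq_top, ← hclosed.submodule_topologicalClosure_eq,
      Submodule.topologicalClosure_eq_top_iff, horth]
  let e := LinearEquiv.ofBijective K ⟨hinj, hsurj⟩
  have he : ∀ x, K (e.symm x) = x := e.apply_symm_apply
  let R : E →L[ℂ] E := (H₀.domain.subtype ∘ₗ e.symm.toLinearMap).mkContinuous 1 fun x => by
    have := hnorm (e.symm x)
    rw [he] at this
    simpa using this
  refine ⟨R, fun x => ⟨(e.symm x).2, ?_⟩, fun u => ?_⟩
  · rw [neg_one_smul, sub_neg_eq_add]
    exact he x
  · rw [neg_one_smul, sub_neg_eq_add]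
    have : e.symm (K u) = u := e.symm_apply_apply u
    exact congrArg Subtype.val this

/-- `S` is a symmetric square root of `(1 + H₀)⁻¹`: its square maps into the domain of `H₀` and is a
two-sided inverse of `1 + H₀`. -/
structure IsHalfResolvent (H₀ : E →ₗ.[ℂ] E) (S : E →L[ℂ] E) : Prop where
  symm : ∀ x y, inner ℂ (S x) y = inner ℂ x (S y)
  mem : ∀ x, S (S x) ∈ H₀.domain
  apply : ∀ x, H₀ ⟨S (S x), mem x⟩ + S (S x) = x
  left : ∀ u : H₀.domain, S (S (H₀ u + (u : E))) = u

theorem exists_isHalfResolvent (hsa : IsSelfAdjoint H₀) (h₀ : Nonneg H₀) :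
    ∃ S : E →L[ℂ] E, IsHalfResolvent H₀ S := by
  obtain ⟨R, hR1, hR2⟩ := neg_one_mem_resolventSet hsa h₀
  simp only [neg_one_smul, sub_neg_eq_add] at hR1 hR2
  choose hmem happ using hR1
  have hsym := isFormalAdjoint_self hsa
  have hpos : R.IsPositive := by
    refine ⟨fun x y => ?_, fun x => ?_⟩
    · change inner ℂ (R x) y = inner ℂ x (R y)
      have h1 := hsym ⟨R x, hmem x⟩ ⟨R y, hmem y⟩
      simp only at h1
      calc inner ℂ (R x) y = inner ℂ (R x) (H₀ ⟨R y, hmem y⟩ + R y) := by rw [happ]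
        _ = inner ℂ (H₀ ⟨R x, hmem x⟩ + R x) (R y) := by
          rw [inner_add_left, inner_add_right, h1]
        _ = inner ℂ x (R y) := by rw [happ]
    · have h1 := energy_add_norm_sq (⟨R x, hmem x⟩ : H₀.domain)
      simp only [happ] at h1
      have h2 := h₀ ⟨R x, hmem x⟩
      change 0 ≤ (inner ℂ (R x) x).re
      rw [← h1]
      positivity
  have hR0 : 0 ≤ R := (ContinuousLinearMap.nonneg_iff_isPositive R).2 hpos
  have hsq : CFC.sqrt R * CFC.sqrt R = R := CFC.sqrt_mul_sqrt_self R hR0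
  have hsq' : ∀ x, CFC.sqrt R (CFC.sqrt R x) = R x := fun x =>
    congrArg (fun X : E →L[ℂ] E => X x) hsq
  refine ⟨CFC.sqrt R, ?_, ?_, ?_, ?_⟩
  · exact (CFC.sqrt_nonneg R).isSelfAdjoint.isSymmetric
  · intro x
    rw [hsq']
    exact hmem x
  · intro x
    simp only [hsq']
    exact happ x
  · intro u
    rw [hsq']
    exact hR2 u

end HalfResolvent

/-! ### The form sum -/

section FormSum

variable {E : Type*} [NormedAddCommGroup E] [InnerProductSpace ℂ E] {H₀ : E →ₗ.[ℂ] E}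
  {S : E →L[ℂ] E}

theorem IsHalfResolvent.injective (hS : IsHalfResolvent H₀ S) : Function.Injective S := by
  rw [injective_iff_map_eq_zero]
  intro x hx
  have h := hS.apply x
  have h0 : (⟨S (S x), hS.mem x⟩ : H₀.domain) = 0 := Subtype.ext (by simp [hx])
  rw [h0, LinearPMap.map_zero, hx, map_zero, add_zero] at h
  exact h.symm

theorem IsHalfResolvent.denseRange [CompleteSpace E] (hS : IsHalfResolvent H₀ S) :
    DenseRange S := by
  have h : S.rangeᗮ = ⊥ := by
    refine (Submodule.eq_bot_iff _).2 fun f hf => ?_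
    have h1 : inner ℂ (S (S f)) f = 0 := hf _ ⟨S f, rfl⟩
    rw [hS.symm, inner_self_eq_zero] at h1
    exact hS.injective (by rw [h1, map_zero])
  have := Submodule.topologicalClosure_eq_top_iff.2 h
  exact Submodule.dense_iff_topologicalClosure_eq_top.2 this

/-- The element `S² x = (1 + H₀)⁻¹ x` of the domain of `H₀`. -/
def IsHalfResolvent.toDomain (hS : IsHalfResolvent H₀ S) : E →ₗ[ℂ] H₀.domain :=
  (S.toLinearMap ∘ₗ S.toLinearMap).codRestrict H₀.domain hS.mem

/-- The vector `S⁻¹ u = S (1 + H₀) u` for `u` in the domain of `H₀`. -/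
def halfVec (S : E →L[ℂ] E) (u : H₀.domain) : E := S (H₀ u + (u : E))

theorem IsHalfResolvent.apply_halfVec (hS : IsHalfResolvent H₀ S) (u : H₀.domain) :
    S (halfVec S u) = u := hS.left u

theorem IsHalfResolvent.halfVec_toDomain (hS : IsHalfResolvent H₀ S) (x : E) :
    halfVec S (hS.toDomain x) = S x :=
  congrArg S (hS.apply x)

theorem IsHalfResolvent.toDomain_add_self (hS : IsHalfResolvent H₀ S) (u : H₀.domain) :
    hS.toDomain (H₀ u + (u : E)) = u := Subtype.ext (hS.left u)

theorem IsHalfResolvent.inner_add_self (hS : IsHalfResolvent H₀ S) (w u : H₀.domain) :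
    inner ℂ (w : E) (H₀ u) + inner ℂ (w : E) (u : E) = inner ℂ (halfVec S w) (halfVec S u) := by
  rw [← inner_add_right, ← hS.apply_halfVec w, hS.symm, halfVec, halfVec]

/-- `u ↦ S⁻¹ u` is isometric from the form norm of `H₀` to the norm of `E`. -/
theorem IsHalfResolvent.norm_halfVec_sq (hS : IsHalfResolvent H₀ S) (u : H₀.domain) :
    ‖halfVec S u‖ ^ 2 = ‖(u : E)‖ ^ 2 + energy H₀ u := by
  have h := congrArg Complex.re (hS.inner_add_self u u)
  rw [← inner_add_right, ← energy_add_norm_sq, inner_self_eq_norm_sq_to_K] at h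
  have h2 : (((‖halfVec S u‖ : ℝ) : ℂ) ^ 2).re = ‖halfVec S u‖ ^ 2 := by norm_cast
  rw [← h2, add_comm]
  exact h.symm

theorem halfVec_sub (a b : H₀.domain) : halfVec S (a - b) = halfVec S a - halfVec S b := by
  rw [halfVec, halfVec, halfVec, ← map_sub, LinearPMap.map_sub, Submodule.coe_sub]
  congr 1
  abel

/-- The factor `2` comes from estimating the real and the imaginary part separately. The sharp bound
on the quadratic form is `form_operator_bounds`. -/
theorem IsHalfResolvent.norm_form_le (hS : IsHalfResolvent H₀ S) {V : Form H₀}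
    (hV : Hermitian V) {v : ℝ} (hv0 : 0 ≤ v) (hv : RelBounded V v) (w u : H₀.domain) :
    ‖V w u‖ ≤ 2 * v * ‖halfVec S w‖ * ‖halfVec S u‖ := by
  have hre : ∀ w : H₀.domain, |(V w u).re| ≤ v * ‖halfVec S w‖ * ‖halfVec S u‖ := by
    intro w
    refine abs_le_of_sq_le_sq ?_ (by positivity)
    have := form_re_sq_le hV hv w u
    rw [← hS.norm_halfVec_sq, ← hS.norm_halfVec_sq] at this
    refine this.trans (le_of_eq ?_)
    ring
  have him := hre (Complex.I • w)
  have e1 : (V (Complex.I • w) u).re = (V w u).im := by simp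
  have e2 : ‖halfVec S (Complex.I • w)‖ = ‖halfVec S w‖ := by
    rw [halfVec, LinearPMap.map_smul, Submodule.coe_smul, ← smul_add, map_smul, norm_smul,
      Complex.norm_I, one_mul]
    rfl
  rw [e1, e2] at him
  have := Complex.norm_le_abs_re_add_abs_im (V w u)
  linarith [hre w]

/-- The form `V` is bounded with respect to the form norm of `H₀`, hence given by a bounded operator
in the coordinate `S⁻¹ u`. -/
theorem IsHalfResolvent.exists_form_operator [CompleteSpace E] (hS : IsHalfResolvent H₀ S)
    {V : Form H₀} (hV : Hermitian V) {v : ℝ} (hv0 : 0 ≤ v) (hv : RelBounded V v) :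
    ∃ B : E →L[ℂ] E, ∀ w u : H₀.domain, V w u = inner ℂ (B (halfVec S w)) (halfVec S u) := by
  have hdense := hS.denseRange
  have hbound : ∀ y x : E, ‖V (hS.toDomain y) (hS.toDomain x)‖ ≤ 2 * v * ‖S y‖ * ‖S x‖ := by
    intro y x
    have := hS.norm_form_le hV hv0 hv (hS.toDomain y) (hS.toDomain x)
    rwa [hS.halfVec_toDomain, hS.halfVec_toDomain] at this
  have hex : ∀ y : E, ∃ b : E, (∀ x, inner ℂ b (S x) = V (hS.toDomain y) (hS.toDomain x)) ∧
      ‖b‖ ≤ 2 * v * ‖S y‖ := by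
    intro y
    let φ : E →ₗ[ℂ] ℂ := V (hS.toDomain y) ∘ₗ hS.toDomain
    let ψ : E →L[ℂ] ℂ := φ.extendOfNorm S.toLinearMap
    refine ⟨(InnerProductSpace.toDual ℂ E).symm ψ, fun x => ?_, ?_⟩
    · rw [InnerProductSpace.toDual_symm_apply]
      exact LinearMap.extendOfNorm_eq hdense ⟨_, hbound y⟩ x
    · rw [LinearIsometryEquiv.norm_map]
      exact LinearMap.opNorm_extendOfNorm_le hdense (by positivity) (hbound y)
  choose b hb hbn using hex
  have hext : ∀ x y : E, (∀ w, inner ℂ x (S w) = inner ℂ y (S w)) → x = y := by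
    intro x y h
    refine Dense.eq_of_inner_left ℂ hdense ?_
    rintro _ ⟨w, rfl⟩
    exact h w
  let β : E →ₗ[ℂ] E :=
    { toFun := b
      map_add' := fun x y => hext _ _ fun w => by
        rw [inner_add_left, hb, hb, hb, map_add, map_add, LinearMap.add_apply]
      map_smul' := fun c x => hext _ _ fun w => by
        rw [RingHom.id_apply, inner_smul_left, hb, hb, map_smul, map_smulₛₗ, LinearMap.smul_apply,
          smul_eq_mul] }
  refine ⟨β.extendOfNorm S.toLinearMap, fun w u => ?_⟩
  have h1 : ∀ y x : E, inner ℂ (β.extendOfNorm S.toLinearMap (S y)) (S x)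
      = V (hS.toDomain y) (hS.toDomain x) := by
    intro y x
    rw [← hb]
    congr 1
    exact LinearMap.extendOfNorm_eq hdense ⟨_, hbn⟩ y
  have h2 := h1 (H₀ w + (w : E)) (H₀ u + (u : E))
  rw [hS.toDomain_add_self, hS.toDomain_add_self] at h2
  exact h2.symm

theorem IsHalfResolvent.range_halfVec (hS : IsHalfResolvent H₀ S) (x : E) :
    ∃ w : H₀.domain, halfVec S w = S x :=
  ⟨_, hS.halfVec_toDomain x⟩

theorem IsHalfResolvent.denseRange_halfVec [CompleteSpace E] (hS : IsHalfResolvent H₀ S) :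
    DenseRange (halfVec (H₀ := H₀) S) :=
  hS.denseRange.mono (by
    rintro _ ⟨x, rfl⟩
    exact hS.range_halfVec x)

theorem IsHalfResolvent.form_operator_bounds [CompleteSpace E] (hS : IsHalfResolvent H₀ S)
    {V : Form H₀} (hV : Hermitian V) {v : ℝ}
    (hv : RelBounded V v) {B : E →L[ℂ] E}
    (hB : ∀ w u : H₀.domain, V w u = inner ℂ (B (halfVec S w)) (halfVec S u)) :
    ((-v : ℝ) : ℂ) • 1 ≤ B ∧ B ≤ (v : ℂ) • 1 := by
  have hdense := hS.denseRange_halfVec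
  have hsymm : ∀ x y, inner ℂ (B x) y = inner ℂ x (B y) := by
    intro x y
    refine hdense.induction_on₂ (p := fun x y => inner ℂ (B x) y = inner ℂ x (B y)) ?_ ?_ x y
    · exact isClosed_eq (by fun_prop) (by fun_prop)
    · intro w u
      rw [← hB, ← hV u w, hB u w, inner_conj_symm]
  have hquad : ∀ x, -(v * ‖x‖ ^ 2) ≤ (inner ℂ (B x) x).re ∧ (inner ℂ (B x) x).re ≤ v * ‖x‖ ^ 2 := by
    intro x
    refine hdense.induction_on (p := fun x => -(v * ‖x‖ ^ 2) ≤ (inner ℂ (B x) x).re ∧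
      (inner ℂ (B x) x).re ≤ v * ‖x‖ ^ 2) x ?_ ?_
    · exact IsClosed.and (isClosed_le (by fun_prop) (Complex.continuous_re.comp (by fun_prop)))
        (isClosed_le (Complex.continuous_re.comp (by fun_prop)) (by fun_prop))
    · intro u
      rw [← hB, hS.norm_halfVec_sq]
      exact hv u
  have hone : ∀ (c : ℝ) (x : E), inner ℂ (((c : ℂ) • (1 : E →L[ℂ] E)) x) x
      = ((c * ‖x‖ ^ 2 : ℝ) : ℂ) := by
    intro c x
    rw [smul_apply, one_apply_eq_self, inner_smul_left, Complex.conj_ofReal,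
      inner_self_eq_norm_sq_to_K]
    push_cast
    rfl
  have hone' : ∀ (c : ℝ) (x y : E), inner ℂ (((c : ℂ) • (1 : E →L[ℂ] E)) x) y
      = inner ℂ x (((c : ℂ) • (1 : E →L[ℂ] E)) y) := by
    intro c x y
    rw [smul_apply, smul_apply, one_apply_eq_self, one_apply_eq_self, inner_smul_left,
      inner_smul_right, Complex.conj_ofReal]
  constructor
  · rw [ContinuousLinearMap.le_def]
    refine ⟨fun x y => ?_, fun x => ?_⟩
    · change inner ℂ (B x - ((-v : ℝ) : ℂ) • (1 : E →L[ℂ] E) x) y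
        = inner ℂ x (B y - ((-v : ℝ) : ℂ) • (1 : E →L[ℂ] E) y)
      rw [inner_sub_left, inner_sub_right, hsymm]
      congr 1
      exact hone' _ _ _
    · change 0 ≤ (inner ℂ (B x - ((((-v : ℝ) : ℂ) • (1 : E →L[ℂ] E)) x)) x).re
      rw [inner_sub_left, hone, Complex.sub_re, Complex.ofReal_re]
      linarith [(hquad x).1]
  · rw [ContinuousLinearMap.le_def]
    refine ⟨fun x y => ?_, fun x => ?_⟩
    · change inner ℂ ((v : ℂ) • (1 : E →L[ℂ] E) x - B x) y
        = inner ℂ x ((v : ℂ) • (1 : E →L[ℂ] E) y - B y)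
      rw [inner_sub_left, inner_sub_right, hsymm]
      congr 1
      exact hone' _ _ _
    · change 0 ≤ (inner ℂ (((v : ℂ) • (1 : E →L[ℂ] E)) x - B x) x).re
      rw [inner_sub_left, hone, Complex.sub_re, Complex.ofReal_re]
      linarith [(hquad x).2]

theorem IsHalfResolvent.tendsto_form [CompleteSpace E] (hS : IsHalfResolvent H₀ S) {V : Form H₀}
    {B : E →L[ℂ] E}
    (hB : ∀ w u : H₀.domain, V w u = inner ℂ (B (halfVec S w)) (halfVec S u))
    (hBs : IsSelfAdjoint B) (ε : ℝ) {s : ℕ → H₀.domain} {y : E}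
    (hs : Tendsto (fun n => halfVec S (s n)) atTop (𝓝 y)) (w : H₀.domain) :
    Tendsto (fun n => inner ℂ (w : E) (H₀ (s n)) + (ε : ℂ) * V w (s n)) atTop
      (𝓝 (inner ℂ (halfVec S w) ((1 + (ε : ℂ) • B) y) - inner ℂ (w : E) (S y))) := by
  have hsymm : ∀ x y, inner ℂ (B x) y = inner ℂ x (B y) := hBs.isSymmetric
  have e : ∀ n, inner ℂ (w : E) (H₀ (s n)) + (ε : ℂ) * V w (s n)
      = inner ℂ (halfVec S w) ((1 + (ε : ℂ) • B) (halfVec S (s n)))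
        - inner ℂ (w : E) (S (halfVec S (s n))) := by
    intro n
    rw [hB, hsymm, hS.apply_halfVec, add_apply, smul_apply, one_apply_eq_self, inner_add_right,
      ← hS.inner_add_self, inner_smul_right]
    ring
  simp_rw [e]
  exact (tendsto_const_nhds.inner (((1 + (ε : ℂ) • B).continuous.tendsto y).comp hs)).sub
    (tendsto_const_nhds.inner ((S.continuous.tendsto y).comp hs))

/-- Sequences that converge in the form sense correspond under `S` to sequences that converge in
`E`, so that `S⁻¹ u` makes sense for every `u` in the form domain, and the form sum satisfies
`1 + H₀ + ε V = S⁻¹ (1 + ε B) S⁻¹`. -/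
theorem IsHalfResolvent.mem_formSumGraph_iff [CompleteSpace E] (hS : IsHalfResolvent H₀ S)
    (h₀ : Nonneg H₀) {V : Form H₀} {B : E →L[ℂ] E}
    (hB : ∀ w u : H₀.domain, V w u = inner ℂ (B (halfVec S w)) (halfVec S u))
    (hBs : IsSelfAdjoint B) (ε : ℝ) (u f : E) :
    (u, f) ∈ formSumGraph H₀ h₀ V ε ↔ ∃ y, S y = u ∧ (1 + (ε : ℂ) • B) y = S (f + u) := by
  have hdense := hS.denseRange_halfVec
  have hdist : ∀ a b : H₀.domain, dist (halfVec S a) (halfVec S b) ^ 2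
      = ‖(a : E) - b‖ ^ 2 + energy H₀ (a - b) := by
    intro a b
    rw [dist_eq_norm, ← halfVec_sub, hS.norm_halfVec_sq, Submodule.coe_sub]
  constructor
  · rintro ⟨s, ⟨hs1, hs2⟩, hs3⟩
    simp only at hs1 hs3
    have hcau : CauchySeq fun n => halfVec S (s n) := by
      rw [cauchySeq_iff_tendsto_dist_atTop_0]
      have h1 := ((cauchySeq_iff_tendsto_dist_atTop_0.1 hs1.cauchySeq).pow 2).add hs2
      have h2 := h1.sqrt
      simp only [ne_eq, OfNat.ofNat_ne_zero, not_false_eq_true, zero_pow, add_zero,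
        Real.sqrt_zero] at h2
      refine h2.congr fun p => ?_
      rw [dist_eq_norm (s p.1 : E), ← hdist, Real.sqrt_sq dist_nonneg]
    obtain ⟨y, hy⟩ := cauchySeq_tendsto_of_complete hcau
    have hSy : S y = u := by
      refine tendsto_nhds_unique ((S.continuous.tendsto y).comp hy) (hs1.congr fun n => ?_)
      exact (hS.apply_halfVec (s n)).symm
    refine ⟨y, hSy, ?_⟩
    refine Dense.eq_of_inner_right ℂ hdense ?_
    rintro _ ⟨w, rfl⟩
    have h := tendsto_nhds_unique (hs3 w) (hS.tendsto_form hB hBs ε hy w)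
    rw [hSy] at h
    rw [← hS.symm, hS.apply_halfVec, inner_add_right, h]
    ring
  · rintro ⟨y, rfl, hy⟩
    obtain ⟨z, hz, hzy⟩ := mem_closure_iff_seq_limit.1 (hdense y)
    choose s hs using hz
    have hsy : Tendsto (fun n => halfVec S (s n)) atTop (𝓝 y) := by simpa only [hs] using hzy
    refine ⟨s, ⟨?_, ?_⟩, fun w => ?_⟩
    · refine ((S.continuous.tendsto y).comp hsy).congr fun n => ?_
      exact hS.apply_halfVec (s n)
    · have h1 := (cauchySeq_iff_tendsto_dist_atTop_0.1 hsy.cauchySeq).pow 2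
      simp only [ne_eq, OfNat.ofNat_ne_zero, not_false_eq_true, zero_pow] at h1
      refine squeeze_zero (fun p => h₀ _) (fun p => ?_) h1
      rw [hdist]
      linarith [sq_nonneg ‖(s p.1 : E) - s p.2‖]
    · have h := hS.tendsto_form hB hBs ε hsy w
      have e : inner ℂ (halfVec S w) ((1 + (ε : ℂ) • B) y) - inner ℂ (w : E) (S y)
          = inner ℂ (w : E) f := by
        rw [hy, ← hS.symm, hS.apply_halfVec, inner_add_right]
        ring
      rwa [e] at h

/-- `1 + H₀ = S⁻¹ S⁻¹`. The operator `H₀` and its form sum with `0 • V` thus have the same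
factorization. -/
theorem IsHalfResolvent.isFactored (hS : IsHalfResolvent H₀ S) : IsFactored H₀ S 1 := by
  intro u f
  constructor
  · intro h
    obtain ⟨d, hd1, hd2⟩ := LinearPMap.mem_graph_iff _ |>.1 h
    simp only at hd1 hd2
    refine ⟨S (f + u), ?_, rfl⟩
    rw [← hd1, ← hd2, hS.left]
  · rintro ⟨y, rfl, hy⟩
    change y = S (f + S y) at hy
    have h1 := hS.apply (f + S y)
    rw [LinearPMap.mem_graph_iff]
    refine ⟨hS.toDomain (f + S y), ?_, ?_⟩
    · change S (S (f + S y)) = S y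
      rw [← hy]
    · have h2 : S (S (f + S y)) = S y := congrArg S hy.symm
      exact add_right_cancel (h1.trans (congrArg (f + ·) h2.symm))

end FormSum

end EigenvalueShift

end

theorem mainTheorem8
    {E : Type*} [NormedAddCommGroup E] [InnerProductSpace ℂ E] [CompleteSpace E]
    (H₀ : E →ₗ.[ℂ] E) (hsa : IsSelfAdjoint H₀) (h₀ : EigenvalueShift.Nonneg H₀)
    (V : EigenvalueShift.Form H₀) (hV : EigenvalueShift.Hermitian V)
    (v : ℝ) (hv : EigenvalueShift.RelBounded V v) (hv1 : v < 1)
    (l : ℝ) (hl : EigenvalueShift.IsIsolatedEigenvalue H₀ l) :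
    -- the shift bound, for every way of following the isolated eigenvalue from `ε = 0` to `ε = 1`
    (∀ μ : ℝ → ℝ, ContinuousOn μ (Icc 0 1) → μ 0 = l →
      (∀ ε ∈ Icc (0 : ℝ) 1,
        EigenvalueShift.IsIsolatedEigenvalue (EigenvalueShift.formSum H₀ h₀ V ε) (μ ε)) →
      |μ 1 - l| ≤ v * (1 + l)) ∧
    -- the eigenvalue can be followed up to `ε = 1`, unless it is absorbed by the essential spectrum
    (EigenvalueShift.IsDiscreteEigenvalue H₀ l →
      ∃ T : ℝ, 0 < T ∧ T ≤ 1 ∧ ∃ μ : ℝ → ℝ, ContinuousOn μ (Icc 0 T) ∧ μ 0 = l ∧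
        (∀ ε ∈ Ico 0 T,
          EigenvalueShift.IsDiscreteEigenvalue (EigenvalueShift.formSum H₀ h₀ V ε) (μ ε)) ∧
        (∀ ε ∈ Icc 0 T, |μ ε - l| ≤ ε * v * (1 + l)) ∧
        ((T = 1 ∧
            EigenvalueShift.IsDiscreteEigenvalue (EigenvalueShift.formSum H₀ h₀ V 1) (μ 1)) ∨
          μ T ∈ EigenvalueShift.essentialSpectrum (EigenvalueShift.formSum H₀ h₀ V T))) := by
  open EigenvalueShift HermitianPencil in
  obtain ⟨S, hS⟩ := exists_isHalfResolvent hsa h₀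
  have hinj := hS.injective
  -- the bound on `V` forces `0 ≤ v`, because the domain of `H₀` is not trivial
  have hv0 : 0 ≤ v := by
    by_contra! hneg
    refine hl.1 ((Submodule.eq_bot_iff _).2 ?_)
    rintro _ ⟨u, -, rfl⟩
    have h1 := hv u
    have h2 := h₀ u
    have h3 : ‖(u : E)‖ ^ 2 ≤ 0 := by nlinarith [sq_nonneg ‖(u : E)‖]
    exact norm_eq_zero.1 (pow_eq_zero_iff two_ne_zero |>.1 (le_antisymm h3 (sq_nonneg _)))
  obtain ⟨B, hB⟩ := hS.exists_form_operator hV hv0 hv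
  obtain ⟨hB1, hB2⟩ := hS.form_operator_bounds hV hv hB
  have hTsa : IsSelfAdjoint S := ContinuousLinearMap.isSelfAdjoint_iff_isSymmetric.2 hS.symm
  have hT0 : 0 ≤ S * S := by
    have := star_mul_self_nonneg S
    rwa [hTsa.star_eq] at this
  have hBsa : IsSelfAdjoint B := by
    have h1 := (sub_nonneg.2 hB2).isSelfAdjoint
    have h2 : IsSelfAdjoint ((v : ℂ) • (1 : E →L[ℂ] E)) := by
      rw [IsSelfAdjoint, star_smul, star_one, RCLike.star_def, Complex.conj_ofReal]
    have h3 := h2.sub h1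
    rwa [sub_sub_cancel] at h3
  have hadm : Admissible B (S * S) v := ⟨hT0, hv0, hv1, hB1, hB2⟩
  have hfac : ∀ ε, IsFactored (formSum H₀ h₀ V ε) S (1 + (ε : ℂ) • B) := fun ε u f => by
    rw [formSum_graph hsa h₀ hV hv]
    exact hS.mem_formSumGraph_iff h₀ hB hBsa ε u f
  have hunit : ∀ ε ∈ Icc (0 : ℝ) 1, IsUnit (1 + (ε : ℂ) • B) := fun ε hε =>
    (hadm.isStrictlyPositive hε).isUnit
  have hzero : (1 : E →L[ℂ] E) = 1 + ((0 : ℝ) : ℂ) • B := by simp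
  have hiso : ∀ ε ∈ Icc (0 : ℝ) 1, ∀ m : ℝ, IsIsolatedEigenvalue (formSum H₀ h₀ V ε) m ↔
      IsIsolatedPoint (1 + (ε : ℂ) • B) (S * S) (1 + m) := fun ε hε m => by
    rw [← (hfac ε).isIsolatedEigenvalue_iff (hunit ε hε) hinj, add_sub_cancel_left]
  have hdis : ∀ ε ∈ Icc (0 : ℝ) 1, ∀ m : ℝ, IsDiscreteEigenvalue (formSum H₀ h₀ V ε) m ↔
      IsDiscretePoint (1 + (ε : ℂ) • B) (S * S) (1 + m) := fun ε hε m => by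
    rw [← (hfac ε).isDiscreteEigenvalue_iff (hunit ε hε) hinj, add_sub_cancel_left]
  constructor
  · intro μ hμ hμ0 hμi
    have h := hadm.path_dist_le (t := 1) (μ := fun ε => 1 + μ ε) ⟨zero_le_one, le_rfl⟩
      (continuousOn_const.add hμ)
      fun ε hε => (hiso ε ⟨hε.1, hε.2.le⟩ _).1 (hμi ε ⟨hε.1, hε.2.le⟩)
    simpa [hμ0] using h
  · intro hd
    have hd' : IsDiscretePoint (1 + ((0 : ℝ) : ℂ) • B) (S * S) (1 + l) := by
      rw [← hzero, ← hS.isFactored.isDiscreteEigenvalue_iff isUnit_one hinj, add_sub_cancel_left]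
      exact hd
    obtain ⟨t, ht0, ht1, α, hαc, hα0, hαd, hend⟩ := hadm.exists_continuation hd'
    refine ⟨t, ht0, ht1, fun ε => α ε - 1, hαc.sub continuousOn_const, by simp [hα0],
      fun ε hε => ?_, fun ε hε => ?_, ?_⟩
    · rw [hdis ε ⟨hε.1, hε.2.le.trans ht1⟩, add_sub_cancel]
      exact hαd ε hε
    · have h := hadm.path_dist_le (t := ε) ⟨hε.1, hε.2.trans ht1⟩
        (hαc.mono (Icc_subset_Icc_right hε.2))
        fun x hx => (hαd x ⟨hx.1, hx.2.trans_le hε.2⟩).1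
      rw [hα0] at h
      rwa [show α ε - 1 - l = α ε - (1 + l) by ring]
    · refine hend.imp (fun h => ⟨h.1, ?_⟩) fun h => ⟨fun hr => ?_, fun hr => ?_⟩
      · rw [hdis 1 ⟨zero_le_one, le_rfl⟩, add_sub_cancel]
        exact h.2
      · refine h.1 (((hfac t).mem_resolventSet_iff (hunit t ⟨ht0.le, ht1⟩) _).1 ?_)
        rwa [Complex.ofReal_sub, Complex.ofReal_one] at hr
      · rw [hdis t ⟨ht0.le, ht1⟩, add_sub_cancel] at hr
        exact h.2 hr
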